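/- Let $a>0$, let $q:[-a,a]\to\mathbb{C}$ be continuous, let $h\in\mathbb{C}$, and let $K(x,t)=K(x,t;h)$ be a complex-valued function on the region $D=\{(x,t):|x|\le a,\ |t|\le|x|\}$. Put $$Tf(x)=f(x)+\int_{-x}^{x}K(x,t)f(t)\,dt,\qquad x\in[-a,a].$$ We say that $T$ is a transmutation operator if it is a bijective linear operator on $C^2[-a,a]$, continuous together with its inverse in the topology of uniform convergence, such that $-(Tf)''+q\,Tf=T[-f'']$ for all $f\in C^2[-a,a]$. We say that $T$ maps solutions with parameter $h$ if for every $\omega\in\mathbb{C}$ it maps each solution $v$ of $v''+\omega^2v=0$ on $[-a,a]$ to a solution $u=Tv$ of $u''-q(x)u+\omega^2u=0$ on $[-a,a]$ with $u(0)=v(0)$ and $u'(0)=v'(0)+hv(0)$. Then the following are equivalent: 1. $K$ is continuous on $D$, $T$ is a transmutation operator, and $T$ maps solutions with parameter $h$; 2. $K$ is continuous on $D$, and $T$ maps solutions with parameter $h$; 3. $H(u,v)=K(u+v,u-v)$ is a classical solution of the Goursat problem $$\frac{\partial^2H(u,v)}{\partial u\,\partial v}=q(u+v)H(u,v),\qquad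 H(u,0)=\frac h2+\frac12\int_0^uq(s)\,ds,\qquad H(0,v)=\frac h2,$$ in the two triangles $\{u,v>0,\ u+v<a\}$ and $\{u,v<0,\ u+v>-a\}$; that is, $H$ is continuous on the closed triangles, in the open triangles it has continuous first partial derivatives and both mixed second partial derivatives, which equal $q(u+v)H(u,v)$, and the two boundary conditions hold for $|u|\le a$ and $|v|\le a$. If moreover $q\in C^1[-a,a]$, then condition 1 holds if and only if $K$ itself is a classical solution of the Goursat problem $$\Big(\frac{\partial^2}{\partial x^2}-q(x)\Big)K(x,t)=\frac{\partial^2}{\partial t^2}K(x,t),\qquad K(x,x)=\frac h2+\frac12\int_0^xq(s)\,ds,\qquad K(x,-x)=\frac h2,$$ that is, $K$ is continuous on $D$, twice continuously differentiable in $\{|x|<a,\ |t|<|x|\}$ and satisfies the equation there, and the two boundary conditions hold for $|x|\le a$. -/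

import Mathlib

noncomputable section

namespace DarbouxTransmutation

open Set

/-- The Volterra integral operator `T f(x) = f(x) + ∫_{-x}^{x} K(x,t) f(t) dt`. -/
def volterra (K : ℝ → ℝ → ℂ) (f : ℝ → ℂ) (x : ℝ) : ℂ :=
  f x + ∫ t in (-x)..x, K x t * f t

/-- The differential expression `-f'' + q f` on the segment `[-a, a]`
(derivatives at the end points are one-sided). -/
def schrodinger (a : ℝ) (q : ℝ → ℂ) (f : ℝ → ℂ) (x : ℝ) : ℂ :=
  -iteratedDerivWithin 2 f (Icc (-a) a) x + q x * f x

/-- `f` is a (twice continuously differentiable) solution of `f'' - q f + ω² f = 0`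
on `[-a, a]`. -/
def IsSolution (a : ℝ) (q : ℝ → ℂ) (ω : ℂ) (f : ℝ → ℂ) : Prop :=
  ContDiffOn ℝ 2 f (Icc (-a) a) ∧
    ∀ x ∈ Icc (-a) a,
      iteratedDerivWithin 2 f (Icc (-a) a) x - q x * f x + ω ^ 2 * f x = 0

/-- The operator with kernel `K` maps every solution `v` of `v'' + ω² v = 0`, for every complex
`ω`, into a solution `u` of `u'' - q u + ω² u = 0` with `u(0) = v(0)` and
`u'(0) = v'(0) + h v(0)`. -/
def MapsSolutions (a : ℝ) (q : ℝ → ℂ) (h : ℂ) (K : ℝ → ℝ → ℂ) : Prop :=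
  ∀ (ω : ℂ) (v : ℝ → ℂ), IsSolution a (fun _ => 0) ω v →
    IsSolution a q ω (volterra K v) ∧
    volterra K v 0 = v 0 ∧
    derivWithin (volterra K v) (Icc (-a) a) 0 = derivWithin v (Icc (-a) a) 0 + h * v 0

/-- Extension by zero to `ℝ` of a function on `[-a, a]`; only its values on `[-a, a]` are used. -/
def ext {a : ℝ} (f : C(Icc (-a) a, ℂ)) : ℝ → ℂ :=
  Function.extend Subtype.val f 0

theorem ext_apply {a : ℝ} (f : C(Icc (-a) a, ℂ)) (x : Icc (-a) a) : ext f x = f x :=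
  Subtype.val_injective.extend_apply f 0 x

theorem ext_add {a : ℝ} (f g : C(Icc (-a) a, ℂ)) : EqOn (ext (f + g)) (ext f + ext g)
    (Icc (-a) a) := by
  intro x hx
  have h1 := ext_apply (f + g) ⟨x, hx⟩
  have h2 := ext_apply f ⟨x, hx⟩
  have h3 := ext_apply g ⟨x, hx⟩
  simp_all

theorem ext_smul {a : ℝ} (c : ℂ) (f : C(Icc (-a) a, ℂ)) : EqOn (ext (c • f)) (c • ext f)
    (Icc (-a) a) := by
  intro x hx
  have h1 := ext_apply (c • f) ⟨x, hx⟩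
  have h2 := ext_apply f ⟨x, hx⟩
  simp_all

theorem ext_zero {a : ℝ} : EqOn (ext (0 : C(Icc (-a) a, ℂ))) 0 (Icc (-a) a) := by
  intro x hx
  have h1 := ext_apply (0 : C(Icc (-a) a, ℂ)) ⟨x, hx⟩
  simp_all

/-- The space `C²[-a, a]` of complex-valued functions with the topology of uniform convergence,
as a subspace of the Banach space of continuous functions on `[-a, a]`. -/
def C2 (a : ℝ) : Submodule ℂ C(Icc (-a) a, ℂ) where
  carrier := {f | ContDiffOn ℝ 2 (ext f) (Icc (-a) a)}
  add_mem' {f g} hf hg := (ContDiffOn.add hf hg).congr (ext_add f g)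
  zero_mem' := contDiffOn_const.congr ext_zero
  smul_mem' c f hf := (ContDiffOn.const_smul c hf).congr (ext_smul c f)

/-- The Volterra operator with kernel `K` is a transmutation operator on `E = C²[-a, a]` for
the pair `A = -d²/dx² + q(x)`, `B = -d²/dx²`: it is a linear invertible operator `T` of `E`,
continuous together with its inverse, and `A T = T B`. -/
def IsTransmutation (a : ℝ) (q : ℝ → ℂ) (K : ℝ → ℝ → ℂ) : Prop :=
  ∃ T : C2 a ≃L[ℂ] C2 a,
    (∀ u : C2 a, ∀ x ∈ Icc (-a) a, ext (T u).1 x = volterra K (ext u.1) x) ∧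
    ∀ u : C2 a, ∀ x ∈ Icc (-a) a,
      schrodinger a q (ext (T u).1) x =
        volterra K (schrodinger a (fun _ => 0) (ext u.1)) x

/-- The closed region `|x| ≤ a`, `|t| ≤ |x|`, where a Volterra kernel lives. -/
def closedRegion (a : ℝ) : Set (ℝ × ℝ) := {p | |p.1| ≤ a ∧ |p.2| ≤ |p.1|}

/-- The open region `|x| < a`, `|t| < |x|`. -/
def openRegion (a : ℝ) : Set (ℝ × ℝ) := {p | |p.1| < a ∧ |p.2| < |p.1|}

/-- `K` is continuous up to the boundary of its region. -/
def IsContinuousKernel (a : ℝ) (K : ℝ → ℝ → ℂ) : Prop :=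
  ContinuousOn (fun p : ℝ × ℝ => K p.1 p.2) (closedRegion a)

/-- The union of the two closed triangles `u, v ≥ 0, u + v ≤ a` and `u, v ≤ 0, u + v ≥ -a`. -/
def closedTriangles (a : ℝ) : Set (ℝ × ℝ) :=
  {p | (0 ≤ p.1 ∧ 0 ≤ p.2 ∧ p.1 + p.2 ≤ a) ∨ (p.1 ≤ 0 ∧ p.2 ≤ 0 ∧ -a ≤ p.1 + p.2)}

/-- The union of the two open triangles `u, v > 0, u + v < a` and `u, v < 0, u + v > -a`. -/
def openTriangles (a : ℝ) : Set (ℝ × ℝ) :=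
  {p | (0 < p.1 ∧ 0 < p.2 ∧ p.1 + p.2 < a) ∨ (p.1 < 0 ∧ p.2 < 0 ∧ -a < p.1 + p.2)}

/-- `H` is a classical solution of the Goursat problem `H_uv = q(u+v) H`,
`H(u,0) = h/2 + ½ ∫_0^u q`, `H(0,v) = h/2`: it is continuous on the closed triangles and
inside them has continuous first partial derivatives `Hu`, `Hv` and the mixed second
derivatives, which satisfy the equation. -/
def IsGoursatSolution (a : ℝ) (q : ℝ → ℂ) (h : ℂ) (H : ℝ → ℝ → ℂ) : Prop :=
  ContinuousOn (fun p : ℝ × ℝ => H p.1 p.2) (closedTriangles a) ∧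
  (∃ Hu Hv : ℝ → ℝ → ℂ,
    ContinuousOn (fun p : ℝ × ℝ => Hu p.1 p.2) (openTriangles a) ∧
    ContinuousOn (fun p : ℝ × ℝ => Hv p.1 p.2) (openTriangles a) ∧
    ∀ u v : ℝ, (u, v) ∈ openTriangles a →
      HasDerivAt (fun s => H s v) (Hu u v) u ∧
      HasDerivAt (fun s => H u s) (Hv u v) v ∧
      HasDerivAt (fun s => Hu u s) (q (u + v) * H u v) v ∧
      HasDerivAt (fun s => Hv s v) (q (u + v) * H u v) u) ∧
  (∀ u ∈ Icc (-a) a, H u 0 = h / 2 + 1 / 2 * ∫ s in (0 : ℝ)..u, q s) ∧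
  ∀ v ∈ Icc (-a) a, H 0 v = h / 2

/-- `K` is a classical solution of the Goursat problem `(∂_x² - q(x)) K = ∂_t² K`,
`K(x,x) = h/2 + ½ ∫_0^x q`, `K(x,-x) = h/2`: it is continuous on the closed region, twice
continuously differentiable inside, and satisfies the equation there. -/
def IsHyperbolicGoursatSolution (a : ℝ) (q : ℝ → ℂ) (h : ℂ) (K : ℝ → ℝ → ℂ) : Prop :=
  ContinuousOn (fun p : ℝ × ℝ => K p.1 p.2) (closedRegion a) ∧
  ContDiffOn ℝ 2 (fun p : ℝ × ℝ => K p.1 p.2) (openRegion a) ∧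
  (∀ x t : ℝ, (x, t) ∈ openRegion a →
    iteratedDeriv 2 (fun s => K s t) x - q x * K x t = iteratedDeriv 2 (fun s => K x s) t) ∧
  (∀ x ∈ Icc (-a) a, K x x = h / 2 + 1 / 2 * ∫ s in (0 : ℝ)..x, q s) ∧
  ∀ x ∈ Icc (-a) a, K x (-x) = h / 2

/-- `K` is the (continuous) kernel of a transmutation operator that maps solutions as described
in `MapsSolutions`. -/
def IsTransmutationKernel (a : ℝ) (q : ℝ → ℂ) (h : ℂ) (K : ℝ → ℝ → ℂ) : Prop :=
  IsContinuousKernel a K ∧ IsTransmutation a q K ∧ MapsSolutions a q h K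

end DarbouxTransmutation

end

noncomputable section

namespace DarbouxTransmutation

open Set MeasureTheory intervalIntegral Filter Topology
open scoped Nat

/-! Integrating twice turns the characteristic Goursat problem into the equation H = `goursatRHS` H.
It is of Volterra type: each application of the double integral gains a factor |u|/(n+1), so the
Neumann series converges and a solution H exists on the whole square (`exists_eq_goursatRHS`).
Everything rests on this one kernel `kernelOf H`: it has all the properties in question, and each of
the properties determines the kernel.

It maps solutions because of one identity. For a solution v of v'' + ω²v = 0, with S = sin ωx / ω,
the integral of v(2y - x) over [b, c] is S(c - b) v(c + b - x). Inserting the integral equation for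
H into Tv and changing the order of integration gives the Duhamel formula Tv(x) = v(x) + h v(0) S(x)
+ ∫ S(x - s) q(s) Tv(s) ds (`volterra_kernelOf_eq`), which is u'' - qu + ω²u = 0 together with the
initial conditions.

A continuous kernel that maps solutions is unique: the images of the exponentials are fixed by the
Cauchy problem, and the exponentials are dense in C[-a, a] (`MapsSolutions.kernel_unique`). A
Goursat solution is unique because the difference of two vanishes on the axes and iterated
integration bounds it by terms of an exponential series (`eq_zero_of_goursat_homogeneous`).

Mapping solutions gives transmutation by density again. With J the twofold primitive from 0, the
relation T J = J (q T J + T) holds on exponentials, hence on all of C[-a, a] since every operator in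
it is bounded. It says that (Tf)'' = q Tf + T f''. As T is invertible on C[-a, a] by the Volterra
estimate, it remains to see that it maps C² onto C² (`MapsSolutions.isTransmutation`).

For a C¹ potential the integral equation makes H of class C², and in characteristic coordinates the
wave operator becomes the mixed derivative. -/

/-! ### Factorial estimates and inversion of Volterra-type operators. -/

theorem norm_integral_le_pow_div_factorial {g : ℝ → ℂ} {x c : ℝ} {n : ℕ}
    (hg : ∀ t ∈ uIcc 0 x, ‖g t‖ ≤ c * |t| ^ n / n !) :
    ‖∫ t in (0 : ℝ)..x, g t‖ ≤ c * |x| ^ (n + 1) / (n + 1)! := by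
  have main : ∀ (g : ℝ → ℂ) (x : ℝ), 0 ≤ x → (∀ t ∈ Icc 0 x, ‖g t‖ ≤ c * |t| ^ n / n !) →
      ‖∫ t in (0 : ℝ)..x, g t‖ ≤ c * |x| ^ (n + 1) / (n + 1)! := by
    intro g x hx hg
    have h1 : ‖∫ t in (0 : ℝ)..x, g t‖ ≤ ∫ t in (0 : ℝ)..x, c / n ! * t ^ n := by
      refine norm_integral_le_of_norm_le hx (Eventually.of_forall fun t ht => ?_)
        (Continuous.intervalIntegrable (by fun_prop) _ _)
      refine (hg t ⟨ht.1.le, ht.2⟩).trans_eq ?_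
      rw [abs_of_pos ht.1]
      ring
    refine h1.trans_eq ?_
    rw [intervalIntegral.integral_const_mul, integral_pow, abs_of_nonneg hx, Nat.factorial_succ]
    have : (n ! : ℝ) ≠ 0 := by positivity
    push_cast
    field_simp
    simp
  rcases le_total 0 x with hx | hx
  · exact main g x hx (by rwa [uIcc_of_le hx] at hg)
  · have h := main (fun t => g (-t)) (-x) (by linarith) fun t ht => by
      simpa using hg (-t) (by rw [uIcc_of_ge hx]; constructor <;> linarith [ht.1, ht.2])
    rw [intervalIntegral.integral_comp_neg (fun t => g t)] at h
    rw [intervalIntegral.integral_symm, norm_neg]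
    simpa using h

/-- Iterating the hypothesis gives ‖Aⁿ‖ ≤ (MR)ⁿ/n!, so some power has norm below 1. Then 1 - Aⁿ is
invertible, and 1 - A is a commuting factor of it. -/
theorem isUnit_one_sub_of_factorial_gain {X : Type*} [TopologicalSpace X] [CompactSpace X]
    (A : C(X, ℂ) →L[ℂ] C(X, ℂ)) (ρ : X → ℝ) (R M : ℝ) (hρ : ∀ x, 0 ≤ ρ x) (hρR : ∀ x, ρ x ≤ R)
    (hM : 0 ≤ M)
    (hA : ∀ (n : ℕ) (f : C(X, ℂ)) (L : ℝ), 0 ≤ L → (∀ x, ‖f x‖ ≤ L * ρ x ^ n / n !) →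
      ∀ x, ‖A f x‖ ≤ M * L * ρ x ^ (n + 1) / (n + 1)!) : IsUnit (1 - A) := by
  rcases isEmpty_or_nonempty X with hX | hX
  · have : Subsingleton C(X, ℂ) := ⟨fun f g => ContinuousMap.ext fun x => isEmptyElim x⟩
    exact ⟨1, ContinuousLinearMap.ext fun f => Subsingleton.elim _ _⟩
  have hR : 0 ≤ R := (hρ (Classical.arbitrary X)).trans (hρR _)
  have hpow : ∀ (n : ℕ) (f : C(X, ℂ)) x, ‖(A ^ n) f x‖ ≤ M ^ n * ‖f‖ * ρ x ^ n / n ! := by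
    intro n f
    induction n with
    | zero => intro x; simpa using f.norm_coe_le_norm x
    | succ n ih =>
      intro x
      have := hA n ((A ^ n) f) (M ^ n * ‖f‖) (by positivity) ih x
      rw [pow_succ', mul_apply_eq_comp]
      refine this.trans_eq ?_
      ring
  have hnorm : ∀ n : ℕ, ‖A ^ n‖ ≤ (M * R) ^ n / n ! := by
    intro n
    refine ContinuousLinearMap.opNorm_le_bound _ (by positivity) fun f => ?_
    refine (ContinuousMap.norm_le _ (by positivity)).2 fun x => (hpow n f x).trans ?_
    rw [mul_pow]
    have : ρ x ^ n ≤ R ^ n := pow_le_pow_left₀ (hρ x) (hρR x) n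
    calc M ^ n * ‖f‖ * ρ x ^ n / n ! ≤ M ^ n * ‖f‖ * R ^ n / n ! := by gcongr
      _ = _ := by ring
  obtain ⟨n, hn⟩ := ((FloorSemiring.tendsto_pow_div_factorial_atTop (M * R)).eventually
    (gt_mem_nhds one_pos)).exists
  have h1 := isUnit_one_sub_of_norm_lt_one (x := A ^ n) ((hnorm n).trans_lt hn)
  rw [← geom_sum_mul_neg] at h1
  refine ((Commute.isUnit_mul_iff ?_).1 h1).2
  exact (Commute.sum_left _ _ _ fun i _ =>
    ((Commute.one_right _).sub_right ((Commute.refl A).pow_left i)))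

/-! ### Density of the exponentials. -/

/-- The exponential `t ↦ e^{(k+1)t}` on `[-a, a]`. -/
def expMap (a : ℝ) (k : ℕ) : C(Icc (-a) a, ℂ) :=
  ⟨fun t => Complex.exp ((k + 1 : ℂ) * (t : ℝ)), by fun_prop⟩

/-- Under y = e^t the span becomes the polynomials in y without constant term, so Weierstrass is
applied to f(log y)/y on [e^{-a}, e^a]. The exponent 0 is left out because the operator identity
below is divided by the square of the exponent. -/
theorem dense_span_expMap {a : ℝ} (ha : 0 < a) :
    Dense (Submodule.span ℂ (range (expMap a)) : Set C(Icc (-a) a, ℂ)) := by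
  have haa : -a ≤ a := by linarith
  have key : ∀ f : C(Icc (-a) a, ℝ), ∀ δ > 0, ∃ P ∈ Submodule.span ℂ (range (expMap a)),
      ∀ t, ‖P t - f t‖ ≤ δ := by
    intro f δ hδ
    have hpos : ∀ y ∈ Icc (Real.exp (-a)) (Real.exp a), y ≠ 0 := fun y hy =>
      ((Real.exp_pos _).trans_le hy.1).ne'
    have hcont : ContinuousOn (fun y => IccExtend haa f (Real.log y) / y)
        (Icc (Real.exp (-a)) (Real.exp a)) := by
      refine ContinuousOn.div ?_ continuousOn_id hpos
      exact (f.continuous.Icc_extend' (h := haa)).comp_continuousOn (Real.continuousOn_log.mono hpos)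
    -- Multiplying back by y = e^t costs a factor of at most e^a.
    obtain ⟨p, hp⟩ := exists_polynomial_near_of_continuousOn _ _ _ hcont (δ / Real.exp a)
      (by positivity)
    refine ⟨∑ k ∈ Finset.range (p.natDegree + 1), (p.coeff k : ℂ) • expMap a k,
      Submodule.sum_mem _ fun k _ => Submodule.smul_mem _ _ (Submodule.subset_span ⟨k, rfl⟩),
      fun t => ?_⟩
    have h1 := hp (Real.exp t) ⟨Real.exp_le_exp.2 t.2.1, Real.exp_le_exp.2 t.2.2⟩
    rw [Real.log_exp, IccExtend_val] at h1
    have h2 : (∑ k ∈ Finset.range (p.natDegree + 1), (p.coeff k : ℂ) • expMap a k) t =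
        ((Real.exp t * p.eval (Real.exp t) : ℝ) : ℂ) := by
      rw [ContinuousMap.sum_apply, Polynomial.eval_eq_sum_range, Finset.mul_sum,
        Complex.ofReal_sum]
      refine Finset.sum_congr rfl fun k _ => ?_
      have : Complex.exp ((k + 1 : ℂ) * (t : ℝ)) = Complex.exp (t : ℝ) * Complex.exp (t : ℝ) ^ k := by
        rw [← Complex.exp_nat_mul, ← Complex.exp_add]; ring_nf
      simp only [ContinuousMap.smul_apply, expMap, ContinuousMap.coe_mk, smul_eq_mul, this]
      push_cast
      ring
    rw [h2, ← Complex.ofReal_sub, Complex.norm_real, Real.norm_eq_abs]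
    have h3 : Real.exp t * p.eval (Real.exp t) - f t =
        Real.exp t * (p.eval (Real.exp t) - f t / Real.exp t) := by
      have := (Real.exp_pos t).ne'
      field_simp
    rw [h3, abs_mul, abs_of_pos (Real.exp_pos _)]
    calc _ ≤ Real.exp a * (δ / Real.exp a) :=
          mul_le_mul (Real.exp_le_exp.2 t.2.2) h1.le (abs_nonneg _) (Real.exp_pos _).le
      _ = δ := by field_simp
  rw [Metric.dense_iff]
  intro f ε hε
  obtain ⟨P, hP, hPf⟩ := key ⟨fun t => (f t).re, by fun_prop⟩ (ε / 3) (by positivity)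
  obtain ⟨Q, hQ, hQf⟩ := key ⟨fun t => (f t).im, by fun_prop⟩ (ε / 3) (by positivity)
  refine ⟨P + Complex.I • Q, ?_, Submodule.add_mem _ hP (Submodule.smul_mem _ _ hQ)⟩
  rw [Metric.mem_ball, dist_eq_norm]
  refine lt_of_le_of_lt ((ContinuousMap.norm_le _ (by positivity : (0 : ℝ) ≤ 2 * ε / 3)).2
    fun t => ?_) (by linarith)
  have h1 := hPf t
  have h2 := hQf t
  have h3 : (P + Complex.I • Q - f) t =
      (P t - ((f t).re : ℂ)) + Complex.I * (Q t - ((f t).im : ℂ)) := by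
    simp only [ContinuousMap.sub_apply, ContinuousMap.add_apply, ContinuousMap.smul_apply,
      smul_eq_mul]
    linear_combination -(Complex.re_add_im (f t)).symm
  rw [h3]
  refine (norm_add_le _ _).trans ?_
  rw [norm_mul, Complex.norm_I, one_mul]
  simp only [ContinuousMap.coe_mk] at h1 h2
  linarith

/-! ### Partial derivatives, parametric integrals and exchange of integrals. -/

theorem hasFDerivAt_of_partials {F F₁ F₂ : ℝ → ℝ → ℂ} {U : Set (ℝ × ℝ)} (hU : IsOpen U)
    (h₁ : ∀ p ∈ U, HasDerivAt (fun s => F s p.2) (F₁ p.1 p.2) p.1)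
    (h₂ : ∀ p ∈ U, HasDerivAt (fun s => F p.1 s) (F₂ p.1 p.2) p.2)
    (c₁ : ContinuousOn (fun p : ℝ × ℝ => F₁ p.1 p.2) U)
    (c₂ : ContinuousOn (fun p : ℝ × ℝ => F₂ p.1 p.2) U) {p : ℝ × ℝ} (hp : p ∈ U) :
    HasFDerivAt (fun p : ℝ × ℝ => F p.1 p.2)
      ((ContinuousLinearMap.toSpanSingleton ℝ (F₁ p.1 p.2)).coprod
        (ContinuousLinearMap.toSpanSingleton ℝ (F₂ p.1 p.2))) p := by
  have hmem := hU.mem_nhds hp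
  have := hasStrictFDerivAt_uncurry_coprod (𝕜 := ℝ) (u := p) (f := F)
    (f₁ := fun x y => ContinuousLinearMap.toSpanSingleton ℝ (F₁ x y))
    (f₂ := fun x y => ContinuousLinearMap.toSpanSingleton ℝ (F₂ x y))
    (by filter_upwards [hmem] with v hv using (h₁ v hv).hasFDerivAt)
    (by filter_upwards [hmem] with v hv using (h₂ v hv).hasFDerivAt)
    ((ContinuousLinearMap.toSpanSingletonCLE (𝕜 := ℝ) (E := ℂ)).continuous.continuousAt.comp
      (c₁.continuousAt hmem))
    ((ContinuousLinearMap.toSpanSingletonCLE (𝕜 := ℝ) (E := ℂ)).continuous.continuousAt.comp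
      (c₂.continuousAt hmem))
  exact this.hasFDerivAt

theorem contDiffOn_succ_of_partials {n : ℕ} {F F₁ F₂ : ℝ → ℝ → ℂ} {U : Set (ℝ × ℝ)} (hU : IsOpen U)
    (h₁ : ∀ p ∈ U, HasDerivAt (fun s => F s p.2) (F₁ p.1 p.2) p.1)
    (h₂ : ∀ p ∈ U, HasDerivAt (fun s => F p.1 s) (F₂ p.1 p.2) p.2)
    (c₁ : ContDiffOn ℝ n (fun p : ℝ × ℝ => F₁ p.1 p.2) U)
    (c₂ : ContDiffOn ℝ n (fun p : ℝ × ℝ => F₂ p.1 p.2) U) :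
    ContDiffOn ℝ (n + 1) (fun p : ℝ × ℝ => F p.1 p.2) U := by
  refine (contDiffOn_succ_iff_hasFDerivWithinAt_of_uniqueDiffOn hU.uniqueDiffOn).2
    ⟨by simp, _, ?_, fun p hp => (hasFDerivAt_of_partials hU h₁ h₂ c₁.continuousOn c₂.continuousOn
      hp).hasFDerivWithinAt⟩
  have hL := (ContinuousLinearMap.toSpanSingletonCLE (𝕜 := ℝ) (E := ℂ)).contDiff (n := n)
  have e : ∀ p : ℝ × ℝ, (ContinuousLinearMap.toSpanSingleton ℝ (F₁ p.1 p.2)).coprod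
        (ContinuousLinearMap.toSpanSingleton ℝ (F₂ p.1 p.2)) =
      ((ContinuousLinearMap.toSpanSingleton ℝ (F₁ p.1 p.2)).comp (ContinuousLinearMap.fst ℝ ℝ ℝ)) +
      ((ContinuousLinearMap.toSpanSingleton ℝ (F₂ p.1 p.2)).comp (ContinuousLinearMap.snd ℝ ℝ ℝ)) := by
    intro p; ext <;> simp
  simp only [e]
  exact ((hL.comp_contDiffOn c₁).clm_comp contDiffOn_const).add
    ((hL.comp_contDiffOn c₂).clm_comp contDiffOn_const)

theorem hasDerivAt_integral_param {ψ ψ' : ℝ → ℝ → ℂ} (hψ : Continuous fun p : ℝ × ℝ => ψ p.1 p.2)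
    (hψ' : Continuous fun p : ℝ × ℝ => ψ' p.1 p.2)
    (hd : ∀ u β, HasDerivAt (fun s => ψ s β) (ψ' u β) u) (u b c : ℝ) :
    HasDerivAt (fun s => ∫ β in b..c, ψ s β) (∫ β in b..c, ψ' u β) u := by
  obtain ⟨C, hC⟩ := ((isCompact_Icc (a := u - 1) (b := u + 1)).prod
    (isCompact_uIcc (a := b) (b := c))).exists_bound_of_continuousOn hψ'.continuousOn
  have hc1 : ∀ s, Continuous (ψ s) := fun s => hψ.comp (Continuous.prodMk_right s)
  have hc2 : ∀ s, Continuous (ψ' s) := fun s => hψ'.comp (Continuous.prodMk_right s)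
  refine (hasDerivAt_integral_of_dominated_loc_of_deriv_le (s := Icc (u - 1) (u + 1))
    (bound := fun _ => C) (Icc_mem_nhds (by linarith) (by linarith))
    (Eventually.of_forall fun s => (hc1 s).aestronglyMeasurable) ((hc1 u).intervalIntegrable _ _)
    (hc2 u).aestronglyMeasurable ?_ (by simp) (Eventually.of_forall fun β _ s _ => hd s β)).2
  exact Eventually.of_forall fun β hβ s hs => hC (s, β) ⟨hs, uIoc_subset_uIcc hβ⟩

/-- The integral over the square minus that over the complementary triangle has x-derivative ∫_0^x
F(x, y) dy and vanishes at 0. Differentiation instead of Fubini's theorem treats both signs of x at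
once. -/
theorem integral_triangle_swap {F : ℝ → ℝ → ℂ} (hF : Continuous fun p : ℝ × ℝ => F p.1 p.2)
    (x : ℝ) : ∫ s in (0 : ℝ)..x, ∫ y in (0 : ℝ)..s, F s y =
      ∫ y in (0 : ℝ)..x, ∫ s in y..x, F s y := by
  have hF' : Continuous fun p : ℝ × ℝ => F p.2 p.1 := hF.comp continuous_swap
  have hFl : ∀ y, Continuous fun s => F s y := fun y => hF.comp (Continuous.prodMk_left y)
  have hP : Continuous fun p : ℝ × ℝ => ∫ s in (0 : ℝ)..p.1, F s p.2 :=
    continuous_parametric_intervalIntegral_of_continuous (f := fun (p : ℝ × ℝ) s => F s p.2)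
      (hF.comp (by fun_prop : Continuous fun q : (ℝ × ℝ) × ℝ => (q.2, q.1.2))) continuous_fst
  have hQ : Continuous fun p : ℝ × ℝ => ∫ y in (0 : ℝ)..p.2, F p.1 y :=
    continuous_parametric_intervalIntegral_of_continuous (f := fun (p : ℝ × ℝ) s => F p.1 s)
      (hF.comp (by fun_prop : Continuous fun q : (ℝ × ℝ) × ℝ => (q.1.1, q.2))) continuous_snd
  have hPd : Continuous fun y : ℝ => ∫ s in (0 : ℝ)..y, F s y :=
    hP.comp (by fun_prop : Continuous fun y : ℝ => (y, y))
  have hPx : ∀ x, Continuous fun y : ℝ => ∫ s in (0 : ℝ)..x, F s y := fun x =>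
    hP.comp (Continuous.prodMk_right x)
  have hd : ∀ x, HasDerivAt (fun x => (∫ y in (0 : ℝ)..x, ∫ s in (0 : ℝ)..x, F s y) -
      ∫ y in (0 : ℝ)..x, ∫ s in (0 : ℝ)..y, F s y) (∫ y in (0 : ℝ)..x, F x y) x := by
    intro x
    have h1 := hasFDerivAt_of_partials (F := fun x b => ∫ y in (0 : ℝ)..b, ∫ s in (0 : ℝ)..x, F s y)
      (F₁ := fun x b => ∫ y in (0 : ℝ)..b, F x y) (F₂ := fun x b => ∫ s in (0 : ℝ)..x, F s b)
      (p := (x, x)) isOpen_univ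
      (fun p _ => hasDerivAt_integral_param hP hF
        (fun u β => (hFl β).integral_hasStrictDerivAt 0 u |>.hasDerivAt) p.1 0 p.2)
      (fun p _ => (hPx p.1).integral_hasStrictDerivAt 0 p.2 |>.hasDerivAt)
      hQ.continuousOn hP.continuousOn (mem_univ _)
    have h2 := h1.comp_hasDerivAt (f := fun x : ℝ => (x, x)) x ((hasDerivAt_id x).prodMk (hasDerivAt_id x))
    have h3 := h2.sub (hPd.integral_hasStrictDerivAt 0 x).hasDerivAt
    convert! h3 using 1
    simp
  have h0 := integral_eq_sub_of_hasDerivAt (a := 0) (b := x) (fun s _ => hd s)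
    ((hQ.comp (by fun_prop : Continuous fun y : ℝ => (y, y))).intervalIntegrable _ _)
  rw [h0]
  simp only [integral_same, sub_zero]
  rw [← intervalIntegral.integral_sub ((hPx x).intervalIntegrable _ _)
    (hPd.intervalIntegrable _ _)]
  refine intervalIntegral.integral_congr fun y _ => ?_
  exact integral_interval_sub_left ((hFl y).intervalIntegrable _ _)
    ((hFl y).intervalIntegrable _ _)

theorem exists_clm_isUnit_one_sub {X : Type*} [TopologicalSpace X] [CompactSpace X]
    (A : C(X, ℂ) →ₗ[ℂ] C(X, ℂ)) (ρ : X → ℝ) (R M : ℝ) (hρ : ∀ x, 0 ≤ ρ x) (hρR : ∀ x, ρ x ≤ R)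
    (hR : 0 ≤ R) (hM : 0 ≤ M)
    (hA : ∀ (n : ℕ) (f : C(X, ℂ)) (L : ℝ), 0 ≤ L → (∀ x, ‖f x‖ ≤ L * ρ x ^ n / n !) →
      ∀ x, ‖A f x‖ ≤ M * L * ρ x ^ (n + 1) / (n + 1)!) :
    ∃ B : C(X, ℂ) →L[ℂ] C(X, ℂ), (∀ f, B f = A f) ∧ IsUnit (1 - B) := by
  refine ⟨A.mkContinuous (M * R) fun f => ?_, fun f => rfl,
    isUnit_one_sub_of_factorial_gain _ ρ R M hρ hρR hM hA⟩
  refine (ContinuousMap.norm_le _ (by positivity)).2 fun x => ?_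
  have h := hA 0 f ‖f‖ (norm_nonneg _) (fun x => by simpa using f.norm_coe_le_norm x) x
  simp only [zero_add, pow_one, Nat.factorial_one, Nat.cast_one, div_one] at h
  calc _ ≤ M * ‖f‖ * ρ x := h
    _ ≤ M * ‖f‖ * R := by gcongr; exact hρR x
    _ = _ := by ring

section DoubleIntegral

variable {ψ : ℝ → ℝ → ℂ}

theorem continuous_integral_snd (hψ : Continuous fun p : ℝ × ℝ => ψ p.1 p.2) :
    Continuous fun p : ℝ × ℝ => ∫ β in (0 : ℝ)..p.2, ψ p.1 β :=
  continuous_parametric_intervalIntegral_of_continuous (f := fun (p : ℝ × ℝ) s => ψ p.1 s)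
    (hψ.comp (by fun_prop : Continuous fun q : (ℝ × ℝ) × ℝ => (q.1.1, q.2))) continuous_snd

theorem continuous_integral_fst (hψ : Continuous fun p : ℝ × ℝ => ψ p.1 p.2) :
    Continuous fun p : ℝ × ℝ => ∫ α in (0 : ℝ)..p.1, ψ α p.2 :=
  continuous_parametric_intervalIntegral_of_continuous (f := fun (p : ℝ × ℝ) s => ψ s p.2)
    (hψ.comp (by fun_prop : Continuous fun q : (ℝ × ℝ) × ℝ => (q.2, q.1.2))) continuous_fst

theorem continuous_integral_integral (hψ : Continuous fun p : ℝ × ℝ => ψ p.1 p.2) :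
    Continuous fun p : ℝ × ℝ => ∫ α in (0 : ℝ)..p.1, ∫ β in (0 : ℝ)..p.2, ψ α β :=
  continuous_integral_fst (ψ := fun α v => ∫ β in (0 : ℝ)..v, ψ α β) (continuous_integral_snd hψ)

theorem hasDerivAt_integral_integral_fst (hψ : Continuous fun p : ℝ × ℝ => ψ p.1 p.2) (u v : ℝ) :
    HasDerivAt (fun s => ∫ α in (0 : ℝ)..s, ∫ β in (0 : ℝ)..v, ψ α β)
      (∫ β in (0 : ℝ)..v, ψ u β) u :=
  (((continuous_integral_snd hψ).comp (Continuous.prodMk_left v)).integral_hasStrictDerivAt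
    0 u).hasDerivAt

theorem hasDerivAt_integral_integral_snd (hψ : Continuous fun p : ℝ × ℝ => ψ p.1 p.2) (u v : ℝ) :
    HasDerivAt (fun s => ∫ α in (0 : ℝ)..u, ∫ β in (0 : ℝ)..s, ψ α β)
      (∫ α in (0 : ℝ)..u, ψ α v) v :=
  hasDerivAt_integral_param (ψ := fun s α => ∫ β in (0 : ℝ)..s, ψ α β) (ψ' := fun s α => ψ α s)
    ((continuous_integral_snd hψ).comp continuous_swap) (hψ.comp continuous_swap)
    (fun s α => ((hψ.comp (Continuous.prodMk_right α)).integral_hasStrictDerivAt 0 s).hasDerivAt)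
    v 0 u

end DoubleIntegral

/-! ### The Goursat problem: existence and uniqueness. -/

/-- The right-hand side of the integral equation equivalent to the Goursat problem. -/
def goursatRHS (q : ℝ → ℂ) (h : ℂ) (H : ℝ → ℝ → ℂ) (u v : ℝ) : ℂ :=
  h / 2 + 1 / 2 * (∫ s in (0 : ℝ)..u, q s) +
    ∫ α in (0 : ℝ)..u, ∫ β in (0 : ℝ)..v, q (α + β) * H α β

theorem hasDerivAt_goursatRHS_fst {q : ℝ → ℂ} (hq : Continuous q) (h : ℂ) {H : ℝ → ℝ → ℂ}
    (hH : Continuous fun p : ℝ × ℝ => H p.1 p.2) (u v : ℝ) :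
    HasDerivAt (fun s => goursatRHS q h H s v)
      (1 / 2 * q u + ∫ β in (0 : ℝ)..v, q (u + β) * H u β) u :=
  (((hq.integral_hasStrictDerivAt 0 u).hasDerivAt.const_mul (1 / 2)).const_add (h / 2)).add
    (hasDerivAt_integral_integral_fst (ψ := fun α β => q (α + β) * H α β)
      ((hq.comp (by fun_prop)).mul hH) u v)

theorem hasDerivAt_goursatRHS_snd {q : ℝ → ℂ} (hq : Continuous q) (h : ℂ) {H : ℝ → ℝ → ℂ}
    (hH : Continuous fun p : ℝ × ℝ => H p.1 p.2) (u v : ℝ) :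
    HasDerivAt (fun s => goursatRHS q h H u s) (∫ α in (0 : ℝ)..u, q (α + v) * H α v) v :=
  (hasDerivAt_integral_integral_snd (ψ := fun α β => q (α + β) * H α β)
      ((hq.comp (by fun_prop)).mul hH) u v).const_add _

/-- Neumann series on the square: the u-integral supplies the factorial gain in |u|, and the
v-integral only a factor a. On the square, unlike on the triangles, a single continuous function
serves both signs. -/
theorem exists_eq_goursatRHS {a : ℝ} (ha : 0 < a) {q : ℝ → ℂ} (hq : Continuous q) (h : ℂ) :
    ∃ H : ℝ → ℝ → ℂ, (Continuous fun p : ℝ × ℝ => H p.1 p.2) ∧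
      ∀ u ∈ Icc (-a) a, ∀ v ∈ Icc (-a) a, H u v = goursatRHS q h H u v := by
  have haa : -a ≤ a := by linarith
  -- Clamping the coordinates makes the integrands continuous on the whole plane.
  let E : C(Icc (-a) a × Icc (-a) a, ℂ) → ℝ → ℝ → ℂ := fun f α β => f (projIcc _ _ haa α, projIcc _ _ haa β)
  have hE : ∀ f, Continuous fun p : ℝ × ℝ => q (p.1 + p.2) * E f p.1 p.2 := fun f =>
    (hq.comp (by fun_prop)).mul (f.continuous.comp
      ((continuous_projIcc.comp continuous_fst).prodMk (continuous_projIcc.comp continuous_snd)))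
  have hEs : ∀ f α, Continuous fun β : ℝ => q (α + β) * E f α β := fun f α =>
    (hE f).comp (Continuous.prodMk_right α)
  have hEi : ∀ f v, Continuous fun α : ℝ => ∫ β in (0 : ℝ)..v, q (α + β) * E f α β := fun f v =>
    (continuous_integral_snd (ψ := fun α β => q (α + β) * E f α β) (hE f)).comp
      (Continuous.prodMk_left v)
  let A : C(Icc (-a) a × Icc (-a) a, ℂ) →ₗ[ℂ] C(Icc (-a) a × Icc (-a) a, ℂ) :=
    { toFun := fun f => ⟨fun p => ∫ α in (0 : ℝ)..p.1, ∫ β in (0 : ℝ)..p.2, q (α + β) * E f α β,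
        (continuous_integral_integral (ψ := fun α β => q (α + β) * E f α β) (hE f)).comp
          (f := fun p : Icc (-a) a × Icc (-a) a => ((p.1 : ℝ), (p.2 : ℝ)))
          (by fun_prop)⟩
      map_add' := by
        intro f g
        ext p
        simp only [ContinuousMap.coe_mk, ContinuousMap.add_apply]
        rw [← intervalIntegral.integral_add ((hEi f _).intervalIntegrable _ _)
          ((hEi g _).intervalIntegrable _ _)]
        refine intervalIntegral.integral_congr fun α _ => ?_
        rw [← intervalIntegral.integral_add ((hEs f _).intervalIntegrable _ _)
          ((hEs g _).intervalIntegrable _ _)]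
        simp only [E, ContinuousMap.add_apply, mul_add]
      map_smul' := by
        intro c f
        ext p
        simp only [ContinuousMap.coe_mk, ContinuousMap.smul_apply, RingHom.id_apply, smul_eq_mul]
        simp only [← intervalIntegral.integral_const_mul]
        simp only [E, ContinuousMap.smul_apply, smul_eq_mul, mul_left_comm] }
  -- On the square the argument α + β runs over [-2a, 2a], which is why q is taken continuous on all
  -- of ℝ.
  obtain ⟨M, hM⟩ := (isCompact_Icc (a := -(2 * a)) (b := 2 * a)).exists_bound_of_continuousOn
    hq.continuousOn
  have hM0 : 0 ≤ M := (norm_nonneg _).trans (hM 0 ⟨by linarith, by linarith⟩)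
  have huI : ∀ {u t : ℝ}, u ∈ Icc (-a) a → t ∈ uIcc 0 u → t ∈ Icc (-a) a := fun hu ht =>
    (ordConnected_Icc.uIcc_subset ⟨by linarith, by linarith⟩ hu) ht
  obtain ⟨B, hB, hu⟩ := exists_clm_isUnit_one_sub A (fun p => |(p.1 : ℝ)|) a (M * a)
    (fun _ => abs_nonneg _) (fun p => abs_le.2 p.1.2) ha.le (by positivity) (by
      rintro n f L hL hf ⟨u, v⟩
      change ‖∫ α in (0 : ℝ)..u, ∫ β in (0 : ℝ)..v, q (α + β) * E f α β‖ ≤ _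
      refine norm_integral_le_pow_div_factorial fun α hα => ?_
      have hα' := huI u.2 hα
      have hv : |(v : ℝ)| ≤ a := abs_le.2 v.2
      have h1 : ∀ β ∈ uIoc (0 : ℝ) v, ‖q (α + β) * E f α β‖ ≤ M * (L * |α| ^ n / n !) := by
        intro β hβ
        have hβ' := huI v.2 (uIoc_subset_uIcc hβ)
        rw [norm_mul]
        refine mul_le_mul (hM _ ⟨by linarith [hα'.1, hβ'.1], by linarith [hα'.2, hβ'.2]⟩) ?_
          (norm_nonneg _) hM0
        have h2 := hf (projIcc _ _ haa α, projIcc _ _ haa β)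
        have h3 : ((projIcc _ _ haa α : Icc (-a) a) : ℝ) = α := by rw [projIcc_of_mem haa hα']
        simp only [h3] at h2
        exact h2
      refine (norm_integral_le_of_norm_le_const h1).trans ?_
      rw [sub_zero]
      calc _ ≤ M * (L * |α| ^ n / n !) * a := by gcongr
        _ = _ := by ring)
  let g : C(Icc (-a) a × Icc (-a) a, ℂ) := ⟨fun p => h / 2 + 1 / 2 * ∫ s in (0 : ℝ)..p.1, q s, by
    have h1 : Continuous fun u : ℝ => ∫ s in (0 : ℝ)..u, q s :=
      intervalIntegral.continuous_primitive (fun _ _ => hq.intervalIntegrable _ _) 0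
    exact continuous_const.add (continuous_const.mul
      (h1.comp (continuous_subtype_val.comp continuous_fst)))⟩
  obtain ⟨U, hU⟩ := hu
  have hsol : (1 - B) ((↑U⁻¹ : C(Icc (-a) a × Icc (-a) a, ℂ) →L[ℂ] C(Icc (-a) a × Icc (-a) a, ℂ)) g) = g := by
    rw [← hU]
    exact congrArg (fun S : C(Icc (-a) a × Icc (-a) a, ℂ) →L[ℂ] C(Icc (-a) a × Icc (-a) a, ℂ) => S g) U.mul_inv
  set f := (↑U⁻¹ : C(Icc (-a) a × Icc (-a) a, ℂ) →L[ℂ] C(Icc (-a) a × Icc (-a) a, ℂ)) g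
  refine ⟨E f, f.continuous.comp ((continuous_projIcc.comp continuous_fst).prodMk
    (continuous_projIcc.comp continuous_snd)), fun u hu v hv => ?_⟩
  have h1 : f (⟨u, hu⟩, ⟨v, hv⟩) - A f (⟨u, hu⟩, ⟨v, hv⟩) = g (⟨u, hu⟩, ⟨v, hv⟩) := by
    rw [← hB]
    exact congrArg (fun k : C(Icc (-a) a × Icc (-a) a, ℂ) => k (⟨u, hu⟩, ⟨v, hv⟩)) hsol
  have h2 : E f u v = f (⟨u, hu⟩, ⟨v, hv⟩) := by
    simp only [E, projIcc_of_mem haa hu, projIcc_of_mem haa hv]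
  rw [h2, goursatRHS]
  exact sub_eq_iff_eq_add.1 h1

/-- Integrating G_uv = qG over rectangles improves a bound of order uⁿ/n! to one of order
uⁿ⁺¹/(n+1)!. Derivatives are available only in the open triangle, so the rectangles stay off the
axes, and the boundary values enter in the limit by continuity of G. -/
theorem eq_zero_of_goursat_homogeneous {a : ℝ} (ha : 0 < a) {q : ℝ → ℂ}
    (hq : ContinuousOn q (Icc 0 a)) {G Gu : ℝ → ℝ → ℂ}
    (hG : ContinuousOn (fun p : ℝ × ℝ => G p.1 p.2) {p | 0 ≤ p.1 ∧ 0 ≤ p.2 ∧ p.1 + p.2 ≤ a})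
    (h₁ : ∀ u v, 0 < u → 0 < v → u + v < a → HasDerivAt (fun s => G s v) (Gu u v) u)
    (h₂ : ∀ u v, 0 < u → 0 < v → u + v < a →
      HasDerivAt (fun s => Gu u s) (q (u + v) * G u v) v)
    (hu0 : ∀ u ∈ Icc 0 a, G u 0 = 0) (h0v : ∀ v ∈ Icc 0 a, G 0 v = 0)
    {u v : ℝ} (hu : 0 ≤ u) (hv : 0 ≤ v) (huv : u + v ≤ a) : G u v = 0 := by
  set T : Set (ℝ × ℝ) := {p | 0 ≤ p.1 ∧ 0 ≤ p.2 ∧ p.1 + p.2 ≤ a} with hT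
  have hTc : IsCompact T := by
    refine (isCompact_Icc (a := ((0 : ℝ), (0 : ℝ))) (b := (a, a))).of_isClosed_subset ?_ ?_
    · exact (isClosed_le continuous_const continuous_fst).inter
        ((isClosed_le continuous_const continuous_snd).inter
          (isClosed_le (continuous_fst.add continuous_snd) continuous_const))
    · rintro ⟨x, y⟩ ⟨h1, h2, h3⟩
      simp only at h1 h2 h3
      exact ⟨⟨h1, h2⟩, ⟨by simp only; linarith, by simp only; linarith⟩⟩
  obtain ⟨L, hL⟩ := hTc.exists_bound_of_continuousOn hG
  obtain ⟨M, hM⟩ := isCompact_Icc.exists_bound_of_continuousOn hq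
  have hM0 : 0 ≤ M := (norm_nonneg _).trans (hM 0 ⟨le_rfl, ha.le⟩)
  have hL0 : 0 ≤ L := (norm_nonneg _).trans (hL (0, 0) ⟨le_rfl, le_rfl, by simpa using ha.le⟩)
  have bound : ∀ n : ℕ, ∀ u v, 0 < u → 0 < v → u + v < a →
      ‖G u v‖ ≤ L * (M * a) ^ n * u ^ n / n ! := by
    intro n
    induction n with
    | zero => intro u v hu hv huv; simpa using hL (u, v) ⟨hu.le, hv.le, huv.le⟩
    | succ n ih =>
      intro u v hu hv huv
      -- The second difference of G over [τ, u] × [τ, v], bounded by two mean value inequalities in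
      -- place of a double integral: in v for Gu, then in u with the boundary function B.
      have step : ∀ τ, 0 < τ → τ < u → τ < v →
          ‖(G u v - G u τ) - (G τ v - G τ τ)‖ ≤ L * (M * a) ^ (n + 1) * u ^ (n + 1) / (n + 1)! := by
        intro τ hτ hτu hτv
        have hd : ∀ s ∈ Icc τ u, HasDerivAt (fun s => (G s v - G s τ) - (G τ v - G τ τ))
            (Gu s v - Gu s τ) s := fun s hs =>
          ((h₁ s v (by linarith [hs.1]) hv (by linarith [hs.2])).sub
            (h₁ s τ (by linarith [hs.1]) hτ (by linarith [hs.2]))).sub_const _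
        have hB : ∀ s : ℝ, HasDerivAt (fun s : ℝ => L * (M * a) ^ (n + 1) * s ^ (n + 1) / (n + 1)!)
            (M * a * (L * (M * a) ^ n * s ^ n / n !)) s := by
          intro s
          have := ((hasDerivAt_pow (n + 1) s).const_mul (L * (M * a) ^ (n + 1))).div_const
            ((n + 1)! : ℝ)
          convert! this using 1
          rw [Nat.factorial_succ]
          have : (n ! : ℝ) ≠ 0 := by positivity
          push_cast
          field_simp
          ring
        refine image_norm_le_of_norm_deriv_right_le_deriv_boundary (a := τ) (b := u)
          (f := fun s => (G s v - G s τ) - (G τ v - G τ τ)) (f' := fun s => Gu s v - Gu s τ)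
          (B := fun s : ℝ => L * (M * a) ^ (n + 1) * s ^ (n + 1) / (n + 1)!)
          (fun s hs => (hd s hs).continuousAt.continuousWithinAt)
          (fun s hs => (hd s ⟨hs.1, hs.2.le⟩).hasDerivWithinAt) ?_ hB ?_ ⟨hτu.le, le_rfl⟩
        · simp only [sub_self, norm_zero]
          positivity
        · intro s hs
          have hs0 : 0 < s := by linarith [hs.1]
          have := (convex_Icc τ v).norm_image_sub_le_of_norm_hasDerivWithin_le
            (f := fun w => Gu s w) (f' := fun w => q (s + w) * G s w)
            (C := M * (L * (M * a) ^ n * s ^ n / n !)) (x := τ) (y := v)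
            (fun w hw => (h₂ s w hs0 (by linarith [hw.1])
              (by linarith [hw.2, hs.2])).hasDerivWithinAt)
            (fun w hw => by
              rw [norm_mul]
              exact mul_le_mul (hM _ ⟨by linarith [hw.1], by linarith [hw.2, hs.2]⟩)
                (ih s w hs0 (by linarith [hw.1]) (by linarith [hw.2, hs.2])) (norm_nonneg _) hM0)
            ⟨le_rfl, hτv.le⟩ ⟨hτv.le, le_rfl⟩
          refine this.trans ?_
          rw [Real.norm_of_nonneg (by linarith)]
          calc _ ≤ M * (L * (M * a) ^ n * s ^ n / n !) * a := by gcongr; linarith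
            _ = _ := by ring
      have lim : Tendsto (fun τ => ‖(G u v - G u τ) - (G τ v - G τ τ)‖) (𝓝[>] 0)
          (𝓝 ‖(G u v - G u 0) - (G 0 v - G 0 0)‖) := by
        have tend : ∀ γ : ℝ → ℝ × ℝ, Continuous γ → γ 0 ∈ T → (∀ᶠ τ in 𝓝[>] (0 : ℝ), γ τ ∈ T) →
            Tendsto (fun τ => G (γ τ).1 (γ τ).2) (𝓝[>] 0) (𝓝 (G (γ 0).1 (γ 0).2)) := by
          intro γ hγ h0 hev
          exact (hG (γ 0) h0).tendsto.comp (tendsto_nhdsWithin_iff.2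
            ⟨(hγ.tendsto 0).mono_left nhdsWithin_le_nhds, hev⟩)
        have ev : ∀ᶠ τ in 𝓝[>] (0 : ℝ), 0 < τ ∧ τ < min u v :=
          Ioo_mem_nhdsGT (lt_min hu hv)
        have t1 := tend (fun τ => (u, τ)) (by fun_prop) ⟨hu.le, le_rfl, by simp only; linarith⟩ (by
          filter_upwards [ev] with τ hτ
          exact ⟨hu.le, hτ.1.le, by simp only; linarith [hτ.2, min_le_right u v]⟩)
        have t2 := tend (fun τ => (τ, v)) (by fun_prop) ⟨le_rfl, hv.le, by simp only; linarith⟩ (by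
          filter_upwards [ev] with τ hτ
          exact ⟨hτ.1.le, hv.le, by simp only; linarith [hτ.2, min_le_left u v]⟩)
        have t3 := tend (fun τ => (τ, τ)) (by fun_prop) ⟨le_rfl, le_rfl, by simp only; linarith⟩ (by
          filter_upwards [ev] with τ hτ
          exact ⟨hτ.1.le, hτ.1.le, by
            simp only; linarith [hτ.2, min_le_left u v, min_le_right u v]⟩)
        exact ((tendsto_const_nhds.sub t1).sub (t2.sub t3)).norm
      rw [hu0 u ⟨hu.le, by linarith⟩, h0v v ⟨hv.le, by linarith⟩, h0v 0 ⟨le_rfl, ha.le⟩, sub_self,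
        sub_zero, sub_zero] at lim
      refine le_of_tendsto lim ?_
      filter_upwards [Ioo_mem_nhdsGT (lt_min hu hv)] with τ hτ
      exact step τ hτ.1 (hτ.2.trans_le (min_le_left _ _)) (hτ.2.trans_le (min_le_right _ _))
  have hopen : ∀ u v, 0 < u → 0 < v → u + v < a → G u v = 0 := by
    intro u v hu hv huv
    have lim : Tendsto (fun n : ℕ => L * (M * a) ^ n * u ^ n / n !) atTop (𝓝 0) := by
      have := (FloorSemiring.tendsto_pow_div_factorial_atTop (M * a * u)).const_mul L
      simp only [mul_zero] at this
      refine this.congr fun n => ?_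
      rw [mul_pow]
      ring
    have := ge_of_tendsto' lim fun n => bound n u v hu hv huv
    exact norm_le_zero_iff.1 this
  -- Points on the edges are reached along a segment from the interior point (a/3, a/3).
  let γ : ℝ → ℝ × ℝ := fun l => (l * u + (1 - l) * (a / 3), l * v + (1 - l) * (a / 3))
  have hγ : ∀ l ∈ Ioo (0 : ℝ) 1, 0 < (γ l).1 ∧ 0 < (γ l).2 ∧ (γ l).1 + (γ l).2 < a := by
    intro l hl
    have h1 : 0 < (1 - l) * (a / 3) := mul_pos (by linarith [hl.2]) (by linarith)
    have h2 : 0 ≤ l * u := mul_nonneg hl.1.le hu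
    have h3 : 0 ≤ l * v := mul_nonneg hl.1.le hv
    have h4 : l * (u + v) ≤ l * a := mul_le_mul_of_nonneg_left huv hl.1.le
    refine ⟨by simp only [γ]; linarith, by simp only [γ]; linarith, ?_⟩
    simp only [γ]
    nlinarith
  have hγ1 : γ 1 = (u, v) := by simp [γ]
  have ev : ∀ᶠ l in 𝓝[<] (1 : ℝ), l ∈ Ioo (0 : ℝ) 1 := Ioo_mem_nhdsLT one_pos
  have lim : Tendsto (fun l => G (γ l).1 (γ l).2) (𝓝[<] 1) (𝓝 (G u v)) := by
    have hc : ContinuousWithinAt (fun p : ℝ × ℝ => G p.1 p.2) T (γ 1) :=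
      hγ1 ▸ hG (u, v) ⟨hu, hv, huv⟩
    have := hc.tendsto.comp (tendsto_nhdsWithin_iff.2
      ⟨((by fun_prop : Continuous γ).tendsto 1).mono_left nhdsWithin_le_nhds, by
        filter_upwards [ev] with l hl
        exact ⟨(hγ l hl).1.le, (hγ l hl).2.1.le, (hγ l hl).2.2.le⟩⟩)
    rwa [hγ1] at this
  refine tendsto_nhds_unique lim (tendsto_const_nhds.congr' ?_)
  filter_upwards [ev] with l hl
  exact (hopen _ _ (hγ l hl).1 (hγ l hl).2.1 (hγ l hl).2.2).symm

theorem IsGoursatSolution.eqOn {a : ℝ} (ha : 0 < a) {q : ℝ → ℂ}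
    (hq : ContinuousOn q (Icc (-a) a)) {h : ℂ} {H H' : ℝ → ℝ → ℂ}
    (hH : IsGoursatSolution a q h H) (hH' : IsGoursatSolution a q h H') :
    EqOn (fun p : ℝ × ℝ => H p.1 p.2) (fun p : ℝ × ℝ => H' p.1 p.2) (closedTriangles a) := by
  obtain ⟨hc, ⟨Hu, Hv, -, -, hd⟩, hb1, hb2⟩ := hH
  obtain ⟨hc', ⟨Hu', Hv', -, -, hd'⟩, hb1', hb2'⟩ := hH'
  rintro ⟨u, v⟩ (⟨hu, hv, huv⟩ | ⟨hu, hv, huv⟩)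
  · refine sub_eq_zero.1 (eq_zero_of_goursat_homogeneous ha (q := q)
      (G := fun u v => H u v - H' u v) (Gu := fun u v => Hu u v - Hu' u v)
      (hq.mono (Icc_subset_Icc (by linarith) le_rfl)) ((hc.sub hc').mono fun p hp => Or.inl hp)
      (fun u v hu hv huv => ?_) (fun u v hu hv huv => ?_) (fun u hu => ?_) (fun v hv => ?_)
      hu hv huv)
    · exact (hd u v (Or.inl ⟨hu, hv, huv⟩)).1.sub (hd' u v (Or.inl ⟨hu, hv, huv⟩)).1
    · rw [mul_sub]
      exact (hd u v (Or.inl ⟨hu, hv, huv⟩)).2.2.1.sub (hd' u v (Or.inl ⟨hu, hv, huv⟩)).2.2.1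
    · simp only [hb1 u ⟨by linarith [hu.1], hu.2⟩, hb1' u ⟨by linarith [hu.1], hu.2⟩, sub_self]
    · simp only [hb2 v ⟨by linarith [hv.1], hv.2⟩, hb2' v ⟨by linarith [hv.1], hv.2⟩, sub_self]
  -- The negative triangle is reflected through the origin; the two signs cancel in the mixed
  -- derivative, and q(s) becomes q(-s).
  · have key := eq_zero_of_goursat_homogeneous ha (q := fun s => q (-s)) (u := -u) (v := -v)
      (G := fun u v => H (-u) (-v) - H' (-u) (-v))
      (Gu := fun u v => -(Hu (-u) (-v) - Hu' (-u) (-v)))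
      (hq.comp (by fun_prop) fun s hs => ⟨by linarith [hs.2], by linarith [hs.1]⟩)
      ((hc.sub hc').comp (f := fun p : ℝ × ℝ => (-p.1, -p.2)) (by fun_prop)
        fun p hp => Or.inr ⟨by simpa using hp.1, by simpa using hp.2.1, by
          simp only; linarith [hp.2.2]⟩)
      (fun u v hu hv huv => ?_) (fun u v hu hv huv => ?_) (fun u hu => ?_) (fun v hv => ?_)
      (by simpa using hu) (by simpa using hv) (by simp only at huv; linarith)
    · simpa using sub_eq_zero.1 key
    · have hm : (-u, -v) ∈ openTriangles a := Or.inr ⟨by simpa, by simpa, by simp only; linarith⟩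
      have := ((hd _ _ hm).1.sub (hd' _ _ hm).1).scomp u (hasDerivAt_neg u)
      convert! this using 1
      simp
    · have hm : (-u, -v) ∈ openTriangles a := Or.inr ⟨by simpa, by simpa, by simp only; linarith⟩
      have := (((hd _ _ hm).2.2.1.sub (hd' _ _ hm).2.2.1).scomp v (hasDerivAt_neg v)).neg
      convert! this using 1
      simp only [neg_smul, one_smul, neg_neg, mul_sub]
      ring_nf
    · simp only [neg_zero]
      rw [hb1 (-u) ⟨by linarith [hu.2], by linarith [hu.1]⟩,
        hb1' (-u) ⟨by linarith [hu.2], by linarith [hu.1]⟩, sub_self]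
    · simp only [neg_zero]
      rw [hb2 (-v) ⟨by linarith [hv.2], by linarith [hv.1]⟩,
        hb2' (-v) ⟨by linarith [hv.2], by linarith [hv.1]⟩, sub_self]

/-- The kernel `K(x, t) = H((x + t) / 2, (x - t) / 2)`. -/
def kernelOf (H : ℝ → ℝ → ℂ) (x t : ℝ) : ℂ := H ((x + t) / 2) ((x - t) / 2)

theorem kernelOf_add_sub (H : ℝ → ℝ → ℂ) (u v : ℝ) : kernelOf H (u + v) (u - v) = H u v := by
  simp only [kernelOf]
  congr 1 <;> ring

theorem continuous_kernelOf {H : ℝ → ℝ → ℂ} (hH : Continuous fun p : ℝ × ℝ => H p.1 p.2) :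
    Continuous fun p : ℝ × ℝ => kernelOf H p.1 p.2 :=
  hH.comp (by fun_prop : Continuous fun p : ℝ × ℝ => ((p.1 + p.2) / 2, (p.1 - p.2) / 2))

theorem openTriangles_subset (a : ℝ) : openTriangles a ⊆ Ioo (-a) a ×ˢ Ioo (-a) a := by
  rintro ⟨u, v⟩ (⟨h1, h2, h3⟩ | ⟨h1, h2, h3⟩) <;> simp only at h1 h2 h3 <;>
    exact ⟨⟨by simp only; linarith, by simp only; linarith⟩,
      ⟨by simp only; linarith, by simp only; linarith⟩⟩

section GoursatEquation

variable {a : ℝ} {q : ℝ → ℂ} {h : ℂ} {H : ℝ → ℝ → ℂ}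

theorem hasDerivAt_of_eq_goursatRHS (hq : Continuous q)
    (hH : Continuous fun p : ℝ × ℝ => H p.1 p.2)
    (hEq : ∀ u ∈ Icc (-a) a, ∀ v ∈ Icc (-a) a, H u v = goursatRHS q h H u v)
    {u v : ℝ} (hu : u ∈ Ioo (-a) a) (hv : v ∈ Ioo (-a) a) :
    HasDerivAt (fun s => H s v) (1 / 2 * q u + ∫ β in (0 : ℝ)..v, q (u + β) * H u β) u ∧
    HasDerivAt (fun s => H u s) (∫ α in (0 : ℝ)..u, q (α + v) * H α v) v := by
  constructor
  · refine (hasDerivAt_goursatRHS_fst hq h hH u v).congr_of_eventuallyEq ?_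
    filter_upwards [Ioo_mem_nhds hu.1 hu.2] with s hs
    exact hEq s (Ioo_subset_Icc_self hs) v (Ioo_subset_Icc_self hv)
  · refine (hasDerivAt_goursatRHS_snd hq h hH u v).congr_of_eventuallyEq ?_
    filter_upwards [Ioo_mem_nhds hv.1 hv.2] with s hs
    exact hEq u (Ioo_subset_Icc_self hu) s (Ioo_subset_Icc_self hs)

/-- The only term of the u-derivative that could be rough is q(u)/2. It does not depend on v, so a
continuous q suffices for the mixed derivatives. -/
theorem isGoursatSolution_of_eq_goursatRHS (ha : 0 < a) (hq : Continuous q)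
    (hH : Continuous fun p : ℝ × ℝ => H p.1 p.2)
    (hEq : ∀ u ∈ Icc (-a) a, ∀ v ∈ Icc (-a) a, H u v = goursatRHS q h H u v) :
    IsGoursatSolution a q h H := by
  have h0 : (0 : ℝ) ∈ Icc (-a) a := ⟨by linarith, ha.le⟩
  have hc : Continuous fun p : ℝ × ℝ => q (p.1 + p.2) * H p.1 p.2 := (hq.comp (by fun_prop)).mul hH
  refine ⟨hH.continuousOn, ⟨fun u v => 1 / 2 * q u + ∫ β in (0 : ℝ)..v, q (u + β) * H u β,
    fun u v => ∫ α in (0 : ℝ)..u, q (α + v) * H α v, ?_, ?_, fun u v huv => ?_⟩, ?_, ?_⟩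
  · exact ((continuous_const.mul (hq.comp continuous_fst)).add
      (continuous_integral_snd (ψ := fun u β => q (u + β) * H u β) hc)).continuousOn
  · exact (continuous_integral_fst (ψ := fun α v => q (α + v) * H α v) hc).continuousOn
  · have hm := openTriangles_subset a huv
    refine ⟨(hasDerivAt_of_eq_goursatRHS hq hH hEq hm.1 hm.2).1,
      (hasDerivAt_of_eq_goursatRHS hq hH hEq hm.1 hm.2).2, ?_, ?_⟩
    · exact (((hc.comp (Continuous.prodMk_right u)).integral_hasStrictDerivAt
        0 v).hasDerivAt).const_add _
    · exact ((hc.comp (Continuous.prodMk_left v)).integral_hasStrictDerivAt 0 u).hasDerivAt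
  · intro u hu
    rw [hEq u hu 0 h0, goursatRHS]
    simp
  · intro v hv
    rw [hEq 0 h0 v hv, goursatRHS]
    simp

end GoursatEquation

/-! ### Trigonometric pairs and the Duhamel formula. -/

/-- The relations which `C x = cos ωx` and `S x = sin ωx / ω` satisfy. -/
structure IsTrigPair (ω : ℂ) (C S : ℝ → ℂ) : Prop where
  hasDerivAt_cos : ∀ x, HasDerivAt C (-ω ^ 2 * S x) x
  hasDerivAt_sin : ∀ x, HasDerivAt S (C x) x
  sq_add_sq : ∀ x, C x ^ 2 + ω ^ 2 * S x ^ 2 = 1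
  cos_add : ∀ x y, C (x + y) = C x * C y - ω ^ 2 * S x * S y
  sin_add : ∀ x y, S (x + y) = S x * C y + C x * S y
  cos_neg : ∀ x, C (-x) = C x
  sin_neg : ∀ x, S (-x) = -S x
  cos_zero : C 0 = 1
  sin_zero : S 0 = 0

/-- At ω = 0 the pair degenerates to 1 and x, which lets later arguments avoid this case
distinction. -/
theorem exists_isTrigPair (ω : ℂ) : ∃ C S : ℝ → ℂ, IsTrigPair ω C S := by
  by_cases hω : ω = 0
  · subst hω
    exact ⟨fun _ => 1, fun x => x,
      { hasDerivAt_cos := fun x => by simpa using hasDerivAt_const x (1 : ℂ)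
        hasDerivAt_sin := fun x => Complex.ofRealCLM.hasDerivAt
        sq_add_sq := by simp
        cos_add := by simp
        sin_add := by simp
        cos_neg := by simp
        sin_neg := by simp
        cos_zero := rfl
        sin_zero := by simp }⟩
  have hd : ∀ x : ℝ, HasDerivAt (fun x : ℝ => ω * (x : ℂ)) ω x := fun x => by
    simpa using (Complex.ofRealCLM.hasDerivAt (x := x)).const_mul ω
  exact ⟨fun x => Complex.cos (ω * x), fun x => Complex.sin (ω * x) / ω,
    { hasDerivAt_cos := fun x => by
        convert! (Complex.hasDerivAt_cos (ω * x)).comp x (hd x) using 1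
        field_simp
      hasDerivAt_sin := fun x => by
        convert! ((Complex.hasDerivAt_sin (ω * x)).comp x (hd x)).div_const ω using 1
        field_simp
      sq_add_sq := fun x => by
        field_simp
        exact Complex.cos_sq_add_sin_sq _
      cos_add := fun x y => by
        push_cast
        rw [mul_add, Complex.cos_add]
        field_simp
      sin_add := fun x y => by
        push_cast
        rw [mul_add, Complex.sin_add]
        field_simp
      cos_neg := by simp
      sin_neg := fun x => by simp [neg_div]
      cos_zero := by simp
      sin_zero := by simp }⟩

namespace IsTrigPair

variable {ω : ℂ} {C S : ℝ → ℂ}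

theorem continuous_cos (hp : IsTrigPair ω C S) : Continuous C :=
  continuous_iff_continuousAt.2 fun x => (hp.hasDerivAt_cos x).continuousAt

theorem continuous_sin (hp : IsTrigPair ω C S) : Continuous S :=
  continuous_iff_continuousAt.2 fun x => (hp.hasDerivAt_sin x).continuousAt

/-- Since 2c - x = (c - b) + (c + b - x), the addition formulas identify the integrand as the
c-derivative of the right-hand side, which vanishes at c = b. -/
theorem integral_comp_two_mul_sub (hp : IsTrigPair ω C S) (A B : ℂ) (x b c : ℝ) :
    ∫ y in b..c, (A * C (2 * y - x) + B * S (2 * y - x)) =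
      S (c - b) * (A * C (c + b - x) + B * S (c + b - x)) := by
  have hd : ∀ c, HasDerivAt (fun c => S (c - b) * (A * C (c + b - x) + B * S (c + b - x)))
      (A * C (2 * c - x) + B * S (2 * c - x)) c := by
    intro c
    have h1 : HasDerivAt (fun c => S (c - b)) (C (c - b)) c :=
      (hp.hasDerivAt_sin _).comp_sub_const c b
    have hs : HasDerivAt (fun c : ℝ => c + b - x) 1 c := ((hasDerivAt_id c).add_const b).sub_const x
    have h2 : HasDerivAt (fun c => C (c + b - x)) (-ω ^ 2 * S (c + b - x)) c := by
      simpa [Function.comp_def] using! (hp.hasDerivAt_cos (c + b - x)).scomp c hs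
    have h3 : HasDerivAt (fun c => S (c + b - x)) (C (c + b - x)) c := by
      simpa [Function.comp_def] using! (hp.hasDerivAt_sin (c + b - x)).scomp c hs
    convert! h1.mul ((h2.const_mul A).add (h3.const_mul B)) using 1
    rw [show 2 * c - x = (c - b) + (c + b - x) by ring, hp.cos_add, hp.sin_add]
    simp only [Pi.add_apply]
    ring
  have h1 := hp.continuous_cos
  have h2 := hp.continuous_sin
  rw [integral_eq_sub_of_hasDerivAt (fun s _ => hd s)
    (Continuous.intervalIntegrable (by fun_prop) _ _)]
  simp [hp.sin_zero]

end IsTrigPair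

theorem integral_neg_self_eq (f : ℝ → ℂ) (x : ℝ) :
    ∫ t in (-x)..x, f t = 2 * ∫ y in (0 : ℝ)..x, f (2 * y - x) := by
  have := intervalIntegral.integral_comp_mul_sub (a := 0) (b := x) f (two_ne_zero (α := ℝ)) x
  rw [this, show 2 * 0 - x = -x by ring, show 2 * x - x = x by ring]
  simp

section Swap

variable {v S : ℝ → ℂ} (hv : Continuous v) (hS : Continuous S)
  (hvS : ∀ x b c : ℝ, ∫ y in b..c, v (2 * y - x) = S (c - b) * v (c + b - x))

include hv hvS in
theorem integral_primitive_mul_swap {q : ℝ → ℂ} (hq : Continuous q) (x : ℝ) :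
    ∫ y in (0 : ℝ)..x, (∫ s in (0 : ℝ)..y, q s) * v (2 * y - x) =
      ∫ s in (0 : ℝ)..x, q s * (S (x - s) * v s) := by
  simp only [← intervalIntegral.integral_mul_const]
  rw [integral_triangle_swap (F := fun y s => q s * v (2 * y - x))
    ((hq.comp continuous_snd).mul (hv.comp (by fun_prop)))]
  simp only [intervalIntegral.integral_const_mul, hvS]
  simp

include hv hS hvS in
-- Both sides equal the integral of ψ(α, β) S(x - α - β) v(α - β) over the triangle α + β ≤ x
-- (oriented when x < 0); on the right, β = s - α.
theorem integral_integral_mul_swap {ψ : ℝ → ℝ → ℂ}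
    (hψ : Continuous fun p : ℝ × ℝ => ψ p.1 p.2) (x : ℝ) :
    ∫ y in (0 : ℝ)..x, (∫ α in (0 : ℝ)..y, ∫ β in (0 : ℝ)..(x - y), ψ α β) * v (2 * y - x) =
      ∫ s in (0 : ℝ)..x, S (x - s) * ∫ y in (0 : ℝ)..s, ψ y (s - y) * v (2 * y - s) := by
  have lhs : ∫ y in (0 : ℝ)..x, (∫ α in (0 : ℝ)..y, ∫ β in (0 : ℝ)..(x - y), ψ α β) *
      v (2 * y - x) = ∫ α in (0 : ℝ)..x, ∫ β in (0 : ℝ)..(x - α),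
        ψ α β * (S (x - α - β) * v (α - β)) := by
    simp only [← intervalIntegral.integral_mul_const]
    have hc : Continuous fun p : ℝ × ℝ => ∫ β in (0 : ℝ)..(x - p.1), ψ p.2 β * v (2 * p.1 - x) := by
      refine continuous_parametric_intervalIntegral_of_continuous
        (f := fun (p : ℝ × ℝ) β => ψ p.2 β * v (2 * p.1 - x)) ?_ (by fun_prop)
      exact (hψ.comp (by fun_prop : Continuous fun r : (ℝ × ℝ) × ℝ => (r.1.2, r.2))).mul
        (hv.comp (by fun_prop))
    rw [integral_triangle_swap (F := fun y α => ∫ β in (0 : ℝ)..(x - y), ψ α β * v (2 * y - x)) hc]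
    refine intervalIntegral.integral_congr fun α _ => ?_
    have h1 := intervalIntegral.integral_comp_sub_left (a := 0) (b := x - α)
      (fun y => ∫ β in (0 : ℝ)..(x - y), ψ α β * v (2 * y - x)) x
    simp only [sub_sub_cancel, sub_zero] at h1
    rw [← h1, integral_triangle_swap (F := fun z β => ψ α β * v (2 * (x - z) - x))
      ((hψ.comp (by fun_prop : Continuous fun r : ℝ × ℝ => (α, r.2))).mul (hv.comp (by fun_prop)))]
    refine intervalIntegral.integral_congr fun β _ => ?_
    simp only [intervalIntegral.integral_const_mul]
    rw [intervalIntegral.integral_comp_sub_left (fun y => v (2 * y - x)) x, hvS]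
    ring_nf
  have rhs : ∫ s in (0 : ℝ)..x, S (x - s) * ∫ y in (0 : ℝ)..s, ψ y (s - y) * v (2 * y - s) =
      ∫ α in (0 : ℝ)..x, ∫ β in (0 : ℝ)..(x - α), ψ α β * (S (x - α - β) * v (α - β)) := by
    simp only [← intervalIntegral.integral_const_mul]
    rw [integral_triangle_swap (F := fun s y => S (x - s) * (ψ y (s - y) * v (2 * y - s)))
      ((hS.comp (by fun_prop)).mul ((hψ.comp
        (by fun_prop : Continuous fun r : ℝ × ℝ => (r.2, r.1 - r.2))).mul (hv.comp (by fun_prop))))]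
    refine intervalIntegral.integral_congr fun α _ => ?_
    have h1 := intervalIntegral.integral_comp_add_right (a := 0) (b := x - α)
      (fun s => S (x - s) * (ψ α (s - α) * v (2 * α - s))) α
    simp only [add_sub_cancel_right, zero_add, sub_add_cancel] at h1
    rw [← h1]
    refine intervalIntegral.integral_congr fun β _ => ?_
    ring_nf
  rw [lhs, rhs]

end Swap

theorem volterra_kernelOf (H : ℝ → ℝ → ℂ) (v : ℝ → ℂ) (x : ℝ) :
    volterra (kernelOf H) v x = v x + 2 * ∫ y in (0 : ℝ)..x, H y (x - y) * v (2 * y - x) := by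
  rw [volterra, integral_neg_self_eq]
  congr 2
  refine intervalIntegral.integral_congr fun y _ => ?_
  simp only [kernelOf]
  ring_nf

/-- The three terms of the integral equation for H contribute respectively h v(0) S(x), the Duhamel
integral of q v, and that of q times the integral part of Tv. -/
theorem volterra_kernelOf_eq {a : ℝ} {q : ℝ → ℂ} {h : ℂ} {H : ℝ → ℝ → ℂ} (hq : Continuous q)
    (hH : Continuous fun p : ℝ × ℝ => H p.1 p.2)
    (hEq : ∀ u ∈ Icc (-a) a, ∀ v ∈ Icc (-a) a, H u v = goursatRHS q h H u v)
    {v S : ℝ → ℂ} (hv : Continuous v) (hS : Continuous S)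
    (hvS : ∀ x b c : ℝ, ∫ y in b..c, v (2 * y - x) = S (c - b) * v (c + b - x))
    {x : ℝ} (hx : x ∈ Icc (-a) a) :
    volterra (kernelOf H) v x = v x + h * v 0 * S x +
      ∫ s in (0 : ℝ)..x, S (x - s) * (q s * volterra (kernelOf H) v s) := by
  have ha : 0 ≤ a := by linarith [hx.1, hx.2]
  have hψ : Continuous fun p : ℝ × ℝ => q (p.1 + p.2) * H p.1 p.2 := (hq.comp (by fun_prop)).mul hH
  have hxI : ∀ y ∈ uIcc 0 x, y ∈ Icc (-a) a ∧ x - y ∈ Icc (-a) a := by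
    intro y hy
    rcases le_total 0 x with h0 | h0
    · rw [uIcc_of_le h0] at hy
      exact ⟨⟨by linarith [hy.1], by linarith [hy.2, hx.2]⟩,
        ⟨by linarith [hy.2], by linarith [hy.1, hx.2]⟩⟩
    · rw [uIcc_of_ge h0] at hy
      exact ⟨⟨by linarith [hy.1, hx.1], by linarith [hy.2]⟩,
        ⟨by linarith [hy.2, hx.1], by linarith [hy.1]⟩⟩
  have hprim : Continuous fun y : ℝ => ∫ s in (0 : ℝ)..y, q s :=
    intervalIntegral.continuous_primitive (fun _ _ => hq.intervalIntegrable _ _) 0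
  have hdbl : Continuous fun y : ℝ => ∫ α in (0 : ℝ)..y, ∫ β in (0 : ℝ)..(x - y),
      q (α + β) * H α β :=
    (continuous_integral_integral (ψ := fun α β => q (α + β) * H α β) hψ).comp
      (by fun_prop : Continuous fun y : ℝ => (y, x - y))
  have hv' : Continuous fun y : ℝ => v (2 * y - x) := hv.comp (by fun_prop)
  have e1 : ∫ y in (0 : ℝ)..x, H y (x - y) * v (2 * y - x) =
      ∫ y in (0 : ℝ)..x, (h / 2 * v (2 * y - x) +
        1 / 2 * ((∫ s in (0 : ℝ)..y, q s) * v (2 * y - x)) +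
        (∫ α in (0 : ℝ)..y, ∫ β in (0 : ℝ)..(x - y), q (α + β) * H α β) * v (2 * y - x)) := by
    refine intervalIntegral.integral_congr fun y hy => ?_
    rw [hEq y (hxI y hy).1 (x - y) (hxI y hy).2, goursatRHS]
    ring
  have hA : Continuous fun y : ℝ => h / 2 * v (2 * y - x) := continuous_const.mul hv'
  have hB : Continuous fun y : ℝ => 1 / 2 * ((∫ s in (0 : ℝ)..y, q s) * v (2 * y - x)) :=
    continuous_const.mul (hprim.mul hv')
  have hAB : Continuous fun y : ℝ => h / 2 * v (2 * y - x) +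
    1 / 2 * ((∫ s in (0 : ℝ)..y, q s) * v (2 * y - x)) := hA.add hB
  have hD : Continuous fun y : ℝ => (∫ α in (0 : ℝ)..y, ∫ β in (0 : ℝ)..(x - y),
      q (α + β) * H α β) * v (2 * y - x) := hdbl.mul hv'
  rw [volterra_kernelOf, e1, intervalIntegral.integral_add
    (hAB.intervalIntegrable _ _) (hD.intervalIntegrable _ _), intervalIntegral.integral_add
    (hA.intervalIntegrable _ _) (hB.intervalIntegrable _ _), intervalIntegral.integral_const_mul,
    intervalIntegral.integral_const_mul, hvS, integral_primitive_mul_swap hv hvS hq,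
    integral_integral_mul_swap (ψ := fun α β => q (α + β) * H α β) hv hS hvS hψ]
  have hK : Continuous fun s : ℝ => ∫ y in (0 : ℝ)..s, H y (s - y) * v (2 * y - s) :=
    continuous_parametric_intervalIntegral_of_continuous
      (f := fun s y => H y (s - y) * v (2 * y - s))
      ((hH.comp (by fun_prop : Continuous fun r : ℝ × ℝ => (r.2, r.1 - r.2))).mul
        (hv.comp (by fun_prop))) continuous_id
  -- On the line α + β = s the potential is the constant q(s) and leaves the inner integral.
  have e2 : ∫ s in (0 : ℝ)..x, S (x - s) * (q s * volterra (kernelOf H) v s) =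
      (∫ s in (0 : ℝ)..x, q s * (S (x - s) * v s)) +
      2 * ∫ s in (0 : ℝ)..x, S (x - s) * ∫ y in (0 : ℝ)..s,
        q (y + (s - y)) * H y (s - y) * v (2 * y - s) := by
    rw [← intervalIntegral.integral_const_mul, ← intervalIntegral.integral_add]
    · refine intervalIntegral.integral_congr fun s _ => ?_
      simp only [volterra_kernelOf, add_sub_cancel, mul_assoc, intervalIntegral.integral_const_mul]
      ring
    · exact (hq.mul ((hS.comp (by fun_prop)).mul hv)).intervalIntegrable _ _
    · simp only [add_sub_cancel, mul_assoc, intervalIntegral.integral_const_mul]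
      exact (continuous_const.mul ((hS.comp (by fun_prop)).mul (hq.mul hK))).intervalIntegrable _ _
  rw [e2]
  simp only [sub_zero, add_zero, sub_self]
  ring

/-! ### Solutions on the segment and their images under the operator. -/

section Solutions

variable {a : ℝ}

theorem uIcc_zero_subset {x : ℝ} (hx : x ∈ Icc (-a) a) : uIcc 0 x ⊆ Icc (-a) a :=
  ordConnected_Icc.uIcc_subset ⟨by linarith [hx.1, hx.2], by linarith [hx.1, hx.2]⟩ hx

theorem uIcc_neg_subset {x : ℝ} (hx : x ∈ Icc (-a) a) : uIcc (-x) x ⊆ Icc (-a) a :=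
  ordConnected_Icc.uIcc_subset ⟨by linarith [hx.2], by linarith [hx.1]⟩ hx

theorem mem_closedRegion {x t : ℝ} (hx : x ∈ Icc (-a) a) (ht : t ∈ uIcc (-x) x) :
    (x, t) ∈ closedRegion a := by
  refine ⟨abs_le.2 hx, abs_le.2 ?_⟩
  rcases le_total 0 x with h | h
  · rw [uIcc_of_le (by linarith)] at ht
    simpa [abs_of_nonneg h] using ht
  · rw [uIcc_of_ge (by linarith)] at ht
    simpa [abs_of_nonpos h] using ht

theorem volterra_congr {K K' : ℝ → ℝ → ℂ} {f g : ℝ → ℂ}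
    (hK : ∀ p ∈ closedRegion a, K p.1 p.2 = K' p.1 p.2) (hf : EqOn f g (Icc (-a) a)) :
    EqOn (volterra K f) (volterra K' g) (Icc (-a) a) := by
  intro x hx
  simp only [volterra]
  rw [hf hx]
  congr 1
  refine intervalIntegral.integral_congr fun t ht => ?_
  simp only [hK (x, t) (mem_closedRegion hx ht), hf (uIcc_neg_subset hx ht)]

theorem eq_of_hasDerivWithinAt_zero {d : ℝ → ℂ}
    (hd : ∀ x ∈ Icc (-a) a, HasDerivWithinAt d 0 (Icc (-a) a) x) {x : ℝ} (hx : x ∈ Icc (-a) a) :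
    d x = d 0 := by
  have h0 : (0 : ℝ) ∈ Icc (-a) a := ⟨by linarith [hx.1, hx.2], by linarith [hx.1, hx.2]⟩
  have := (convex_Icc (-a) a).norm_image_sub_le_of_norm_hasDerivWithin_le (f := d)
    (f' := fun _ => 0) (C := 0) hd (by simp) h0 hx
  rw [zero_mul] at this
  exact sub_eq_zero.1 (norm_le_zero_iff.1 this)

section TwiceDifferentiable

variable {f w w₁ w₂ : ℝ → ℂ}

theorem iteratedDerivWithin_two (f : ℝ → ℂ) (s : Set ℝ) :
    iteratedDerivWithin 2 f s = derivWithin (derivWithin f s) s := by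
  rw [iteratedDerivWithin_succ, iteratedDerivWithin_one]

theorem derivWithin_eq_of_eqOn (ha : 0 < a) (h₁ : ∀ x, HasDerivAt w (w₁ x) x)
    (hf : EqOn f w (Icc (-a) a)) : EqOn (derivWithin f (Icc (-a) a)) w₁ (Icc (-a) a) :=
  fun x hx => ((h₁ x).hasDerivWithinAt.congr hf (hf hx)).derivWithin
    (uniqueDiffOn_Icc (by linarith) x hx)

theorem iteratedDerivWithin_two_eq_of_eqOn (ha : 0 < a) (h₁ : ∀ x, HasDerivAt w (w₁ x) x)
    (h₂ : ∀ x, HasDerivAt w₁ (w₂ x) x) (hf : EqOn f w (Icc (-a) a)) :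
    EqOn (iteratedDerivWithin 2 f (Icc (-a) a)) w₂ (Icc (-a) a) := by
  intro x hx
  rw [iteratedDerivWithin_two]
  exact derivWithin_eq_of_eqOn ha h₂ (derivWithin_eq_of_eqOn ha h₁ hf) hx

theorem contDiffOn_two_of_eqOn (h₁ : ∀ x, HasDerivAt w (w₁ x) x)
    (h₂ : ∀ x, HasDerivAt w₁ (w₂ x) x) (hc : Continuous w₂) (hf : EqOn f w (Icc (-a) a)) :
    ContDiffOn ℝ 2 f (Icc (-a) a) := by
  have e1 : deriv w = w₁ := funext fun x => (h₁ x).deriv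
  have e2 : deriv w₁ = w₂ := funext fun x => (h₂ x).deriv
  have c1 : ContDiff ℝ 1 w₁ := contDiff_one_iff_deriv.2 ⟨fun x => (h₂ x).differentiableAt, e2 ▸ hc⟩
  have c2 : ContDiff ℝ (1 + 1) w :=
    contDiff_succ_iff_deriv.2 ⟨fun x => (h₁ x).differentiableAt, by simp, e1 ▸ c1⟩
  have e : (1 + 1 : WithTop ℕ∞) = 2 := by norm_num
  exact (e ▸ c2).contDiffOn.congr hf

theorem hasDerivWithinAt_of_contDiffOn_two (ha : 0 < a) (hf : ContDiffOn ℝ 2 f (Icc (-a) a)) :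
    (∀ x ∈ Icc (-a) a,
      HasDerivWithinAt f (derivWithin f (Icc (-a) a) x) (Icc (-a) a) x) ∧
    (∀ x ∈ Icc (-a) a, HasDerivWithinAt (derivWithin f (Icc (-a) a))
      (iteratedDerivWithin 2 f (Icc (-a) a) x) (Icc (-a) a) x) ∧
    ContinuousOn (iteratedDerivWithin 2 f (Icc (-a) a)) (Icc (-a) a) := by
  have hu : UniqueDiffOn ℝ (Icc (-a) a) := uniqueDiffOn_Icc (by linarith)
  have h1 := (contDiffOn_succ_iff_derivWithin (n := 1) hu).1 (by
    have e : (1 + 1 : WithTop ℕ∞) = 2 := by norm_num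
    rwa [e])
  refine ⟨fun x hx => (h1.1 x hx).hasDerivWithinAt, fun x hx => ?_,
    hf.continuousOn_iteratedDerivWithin le_rfl hu⟩
  rw [iteratedDerivWithin_two]
  exact (h1.2.2.differentiableOn one_ne_zero x hx).hasDerivWithinAt

/-- The twofold primitive vanishing to second order at the origin. -/
def primitiveTwice (p : ℝ → ℂ) (x : ℝ) : ℂ := ∫ s in (0 : ℝ)..x, ∫ t in (0 : ℝ)..s, p t

theorem hasDerivAt_primitive {p : ℝ → ℂ} (hp : Continuous p) (x : ℝ) :
    HasDerivAt (fun x => ∫ t in (0 : ℝ)..x, p t) (p x) x :=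
  (hp.integral_hasStrictDerivAt 0 x).hasDerivAt

theorem hasDerivAt_primitiveTwice {p : ℝ → ℂ} (hp : Continuous p) (x : ℝ) :
    HasDerivAt (primitiveTwice p) (∫ t in (0 : ℝ)..x, p t) x :=
  hasDerivAt_primitive (intervalIntegral.continuous_primitive
    (fun _ _ => hp.intervalIntegrable _ _) 0) x

theorem primitiveTwice_add {p r : ℝ → ℂ} (hp : Continuous p) (hr : Continuous r) (x : ℝ) :
    primitiveTwice (fun t => p t + r t) x = primitiveTwice p x + primitiveTwice r x := by
  simp only [primitiveTwice]
  rw [← intervalIntegral.integral_add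
    ((intervalIntegral.continuous_primitive (fun _ _ => hp.intervalIntegrable _ _)
      0).intervalIntegrable _ _)
    ((intervalIntegral.continuous_primitive (fun _ _ => hr.intervalIntegrable _ _)
      0).intervalIntegrable _ _)]
  exact intervalIntegral.integral_congr fun s _ => intervalIntegral.integral_add
    (hp.intervalIntegrable _ _) (hr.intervalIntegrable _ _)

theorem primitiveTwice_const_mul (c : ℂ) (p : ℝ → ℂ) (x : ℝ) :
    primitiveTwice (fun t => c * p t) x = c * primitiveTwice p x := by
  simp only [primitiveTwice, intervalIntegral.integral_const_mul]

theorem continuous_primitiveTwice {p : ℝ → ℂ} (hp : Continuous p) :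
    Continuous (primitiveTwice p) :=
  continuous_iff_continuousAt.2 fun x => (hasDerivAt_primitiveTwice hp x).continuousAt

theorem hasDerivAt_ofReal (x : ℝ) : HasDerivAt (fun x : ℝ => (x : ℂ)) 1 x :=
  Complex.ofRealCLM.hasDerivAt

theorem hasDerivAt_taylor {p : ℝ → ℂ} (hp : Continuous p) (A B : ℂ) (x : ℝ) :
    HasDerivAt (fun x : ℝ => A + B * x + primitiveTwice p x) (B + ∫ t in (0 : ℝ)..x, p t) x := by
  simpa using! (((hasDerivAt_ofReal x).const_mul B).const_add A).add (hasDerivAt_primitiveTwice hp x)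

/-- Taylor's formula with the remainder as a twofold primitive. It trades one-sided second
derivatives for a bounded operator. -/
theorem eq_taylor_of_contDiffOn_two (ha : 0 < a) (hf : ContDiffOn ℝ 2 f (Icc (-a) a))
    {p : ℝ → ℂ} (hp : Continuous p) (hpf : EqOn p (iteratedDerivWithin 2 f (Icc (-a) a)) (Icc (-a) a))
    {x : ℝ} (hx : x ∈ Icc (-a) a) :
    f x = f 0 + derivWithin f (Icc (-a) a) 0 * x + primitiveTwice p x := by
  obtain ⟨h1, h2, -⟩ := hasDerivWithinAt_of_contDiffOn_two ha hf
  set f' := derivWithin f (Icc (-a) a)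
  have e1 : ∀ x ∈ Icc (-a) a, f' x = f' 0 + ∫ t in (0 : ℝ)..x, p t := by
    intro x hx
    have := eq_of_hasDerivWithinAt_zero (d := fun x => f' x - ∫ t in (0 : ℝ)..x, p t)
      (fun x hx => by
        have := (h2 x hx).sub (hasDerivAt_primitive hp x).hasDerivWithinAt
        rwa [← hpf hx, sub_self] at this) hx
    simp only [integral_same, sub_zero] at this
    rw [← this]; ring
  have := eq_of_hasDerivWithinAt_zero
    (d := fun x => f x - (f 0 + f' 0 * x + primitiveTwice p x))
    (fun x hx => by
      have := (h1 x hx).sub (hasDerivAt_taylor hp (f 0) (f' 0) x).hasDerivWithinAt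
      rwa [e1 x hx, sub_self] at this) hx
  simp only [primitiveTwice, integral_same, Complex.ofReal_zero] at this
  rw [sub_eq_iff_eq_add] at this
  rw [this, primitiveTwice]
  ring

end TwiceDifferentiable

/-- The expressions vC - v'S and ω²vS + v'C are constant along a solution, and C² + ω²S² = 1 lets
one solve for v. -/
theorem IsSolution.eq_trig (ha : 0 < a) {ω : ℂ} {v : ℝ → ℂ} (hv : IsSolution a (fun _ => 0) ω v)
    {C S : ℝ → ℂ} (hp : IsTrigPair ω C S) :
    EqOn v (fun x => v 0 * C x + derivWithin v (Icc (-a) a) 0 * S x) (Icc (-a) a) := by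
  obtain ⟨h1, h2, -⟩ := hasDerivWithinAt_of_contDiffOn_two ha hv.1
  set v' := derivWithin v (Icc (-a) a)
  intro x hx
  have hE : ∀ x ∈ Icc (-a) a, iteratedDerivWithin 2 v (Icc (-a) a) x = -ω ^ 2 * v x := by
    intro x hx
    linear_combination hv.2 x hx
  have eA := eq_of_hasDerivWithinAt_zero (d := fun x => v x * C x - v' x * S x) (fun x hx => by
    have := ((h1 x hx).mul (hp.hasDerivAt_cos x).hasDerivWithinAt).sub
      ((h2 x hx).mul (hp.hasDerivAt_sin x).hasDerivWithinAt)
    convert! this using 1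
    rw [hE x hx]
    ring) hx
  have eB := eq_of_hasDerivWithinAt_zero (d := fun x => ω ^ 2 * (v x * S x) + v' x * C x)
    (fun x hx => by
      have := (((h1 x hx).mul (hp.hasDerivAt_sin x).hasDerivWithinAt).const_mul (ω ^ 2)).add
        ((h2 x hx).mul (hp.hasDerivAt_cos x).hasDerivWithinAt)
      convert! this using 1
      rw [hE x hx]
      ring) hx
  simp only [hp.cos_zero, hp.sin_zero, mul_one, mul_zero, sub_zero, zero_add] at eA eB
  simp only
  rw [← eA, ← eB]
  linear_combination -v x * hp.sq_add_sq x

theorem mapsSolutions_kernelOf (ha : 0 < a) {q : ℝ → ℂ} {h : ℂ} {H : ℝ → ℝ → ℂ}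
    (hq : Continuous q) (hH : Continuous fun p : ℝ × ℝ => H p.1 p.2)
    (hEq : ∀ u ∈ Icc (-a) a, ∀ v ∈ Icc (-a) a, H u v = goursatRHS q h H u v) :
    MapsSolutions a q h (kernelOf H) := by
  intro ω v₀ hv₀
  have h0 : (0 : ℝ) ∈ Icc (-a) a := ⟨by linarith, ha.le⟩
  obtain ⟨C, S, hp⟩ := exists_isTrigPair ω
  have hC := hp.continuous_cos
  have hS := hp.continuous_sin
  set A := v₀ 0
  set B := derivWithin v₀ (Icc (-a) a) 0
  set v : ℝ → ℂ := fun x => A * C x + B * S x with hv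
  have hvv : EqOn v₀ v (Icc (-a) a) := hv₀.eq_trig ha hp
  have hvc : Continuous v := by fun_prop
  set u := volterra (kernelOf H) v with hu
  have hV : EqOn (volterra (kernelOf H) v₀) u (Icc (-a) a) :=
    volterra_congr (fun _ _ => rfl) hvv
  have huc : Continuous u := by
    have : u = fun x => v x + 2 * ∫ y in (0 : ℝ)..x, H y (x - y) * v (2 * y - x) :=
      funext fun x => volterra_kernelOf H v x
    rw [this]
    refine hvc.add (continuous_const.mul ?_)
    exact continuous_parametric_intervalIntegral_of_continuous
      (f := fun s y => H y (s - y) * v (2 * y - s))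
      ((hH.comp (by fun_prop : Continuous fun r : ℝ × ℝ => (r.2, r.1 - r.2))).mul
        (hvc.comp (by fun_prop))) continuous_id
  have hv0 : v 0 = A := by simp [hv, hp.cos_zero, hp.sin_zero]
  set P : ℝ → ℂ := fun x => ∫ s in (0 : ℝ)..x, C s * (q s * u s)
  set Q : ℝ → ℂ := fun x => ∫ s in (0 : ℝ)..x, S s * (q s * u s)
  have hPc : Continuous fun s => C s * (q s * u s) := hC.mul (hq.mul huc)
  have hQc : Continuous fun s => S s * (q s * u s) := hS.mul (hq.mul huc)
  have hP : ∀ x, HasDerivAt P (C x * (q x * u x)) x := hasDerivAt_primitive hPc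
  have hQ : ∀ x, HasDerivAt Q (S x * (q x * u x)) x := hasDerivAt_primitive hQc
  -- The Duhamel formula with S(x - s) = S(x)C(s) - C(x)S(s), so that x leaves the integrals. This
  -- form can be differentiated twice on the whole line.
  set w : ℝ → ℂ := fun x => A * C x + B * S x + h * A * S x + (S x * P x - C x * Q x)
  set w₁ : ℝ → ℂ := fun x => A * (-ω ^ 2 * S x) + B * C x + h * A * C x +
    (C x * P x + ω ^ 2 * S x * Q x)
  have hw : EqOn u w (Icc (-a) a) := by
    intro x hx
    rw [hu, volterra_kernelOf_eq hq hH hEq hvc hS (hp.integral_comp_two_mul_sub A B) hx, hv0]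
    have hPx : Continuous fun s => S x * (C s * (q s * u s)) := continuous_const.mul hPc
    have hQx : Continuous fun s => C x * (S s * (q s * u s)) := continuous_const.mul hQc
    simp only [w, P, Q]
    rw [← intervalIntegral.integral_const_mul, ← intervalIntegral.integral_const_mul,
      ← intervalIntegral.integral_sub (hPx.intervalIntegrable _ _) (hQx.intervalIntegrable _ _)]
    simp only [hv]
    congr 1
    refine intervalIntegral.integral_congr fun s _ => ?_
    simp only [sub_eq_add_neg, hp.sin_add, hp.cos_neg, hp.sin_neg]
    ring
  have hw1 : ∀ x, HasDerivAt w (w₁ x) x := by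
    intro x
    have := (((hp.hasDerivAt_cos x).const_mul A).add ((hp.hasDerivAt_sin x).const_mul B)).add
      ((hp.hasDerivAt_sin x).const_mul (h * A)) |>.add
      (((hp.hasDerivAt_sin x).mul (hP x)).sub ((hp.hasDerivAt_cos x).mul (hQ x)))
    convert! this using 1
    simp only [w₁]
    ring
  have hw2 : ∀ x, HasDerivAt w₁ (-ω ^ 2 * w x + q x * u x) x := by
    intro x
    have := ((((hp.hasDerivAt_sin x).const_mul (-ω ^ 2)).const_mul A).add
      ((hp.hasDerivAt_cos x).const_mul B)).add
      ((hp.hasDerivAt_cos x).const_mul (h * A)) |>.add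
      (((hp.hasDerivAt_cos x).mul (hP x)).add
        (((hp.hasDerivAt_sin x).const_mul (ω ^ 2)).mul (hQ x)))
    convert! this using 1
    simp only [w]
    linear_combination (-(q x * u x)) * hp.sq_add_sq x
  have hwc : Continuous w := continuous_iff_continuousAt.2 fun x => (hw1 x).continuousAt
  have hfw : EqOn (volterra (kernelOf H) v₀) w (Icc (-a) a) := hV.trans hw
  refine ⟨⟨contDiffOn_two_of_eqOn hw1 hw2 (by fun_prop) hfw, fun x hx => ?_⟩, ?_, ?_⟩
  · simp only [iteratedDerivWithin_two_eq_of_eqOn ha hw1 hw2 hfw hx, hfw hx, hw hx]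
    ring
  · simp [volterra, A]
  · rw [derivWithin_eq_of_eqOn ha hw1 hfw h0]
    simp [w₁, P, Q, hp.cos_zero, hp.sin_zero]

end Solutions

/-! ### Bounded operators on C[-a, a]. -/

section Operators

variable {a : ℝ}

/-- Each substitution of the equation into itself gains two powers of |x|. This one estimate yields
both uniqueness for the Cauchy problem and surjectivity of T on C². -/
theorem eqOn_zero_of_eq_primitiveTwice {p d : ℝ → ℂ} (hp : Continuous p)
    (hd : ContinuousOn d (Icc (-a) a))
    (hE : ∀ x ∈ Icc (-a) a, d x = primitiveTwice (fun s => p s * d s) x) :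
    EqOn d 0 (Icc (-a) a) := by
  obtain ⟨M, hM⟩ := isCompact_Icc.exists_bound_of_continuousOn (hp.continuousOn (s := Icc (-a) a))
  obtain ⟨L, hL⟩ := isCompact_Icc.exists_bound_of_continuousOn hd
  have bound : ∀ n : ℕ, ∀ x ∈ Icc (-a) a, ‖d x‖ ≤ M ^ n * L * |x| ^ (2 * n) / (2 * n)! := by
    intro n
    induction n with
    | zero => intro x hx; simpa using hL x hx
    | succ n ih =>
      intro x hx
      have hM0 : 0 ≤ M := (norm_nonneg _).trans (hM x hx)
      rw [hE x hx, primitiveTwice]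
      refine norm_integral_le_pow_div_factorial (n := 2 * n + 1) fun s hs => ?_
      refine norm_integral_le_pow_div_factorial (n := 2 * n) fun t ht => ?_
      have hs' := uIcc_zero_subset hx hs
      have ht' := uIcc_zero_subset hs' ht
      rw [norm_mul]
      calc _ ≤ M * (M ^ n * L * |t| ^ (2 * n) / (2 * n)!) :=
            mul_le_mul (hM t ht') (ih t ht') (norm_nonneg _) hM0
        _ = _ := by ring
  intro x hx
  have hM0 : 0 ≤ M := (norm_nonneg _).trans (hM x hx)
  -- Apart from L, these are the even-indexed terms of the exponential series of √M |x|.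
  have lim : Tendsto (fun n : ℕ => M ^ n * L * |x| ^ (2 * n) / (2 * n)!) atTop (𝓝 0) := by
    have h1 := ((FloorSemiring.tendsto_pow_div_factorial_atTop (Real.sqrt M * |x|)).comp
      (tendsto_id.const_mul_atTop' (r := 2) two_pos)).const_mul L
    simp only [mul_zero] at h1
    refine h1.congr fun n => ?_
    simp only [Function.comp, id, mul_pow, pow_mul, Real.sq_sqrt hM0]
    ring
  exact norm_le_zero_iff.1 (ge_of_tendsto' lim fun n => bound n x hx)

/-- The continuous extension to `ℝ` of a function on `[-a, a]`, constant outside. -/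
def contExt (ha : 0 < a) (f : C(Icc (-a) a, ℂ)) : ℝ → ℂ := IccExtend (neg_le_self ha.le) f

theorem continuous_contExt (ha : 0 < a) (f : C(Icc (-a) a, ℂ)) : Continuous (contExt ha f) :=
  f.continuous.Icc_extend'

theorem contExt_of_mem (ha : 0 < a) (f : C(Icc (-a) a, ℂ)) {x : ℝ} (hx : x ∈ Icc (-a) a) :
    contExt ha f x = f ⟨x, hx⟩ := IccExtend_of_mem _ _ hx

theorem contExt_val (ha : 0 < a) (f : C(Icc (-a) a, ℂ)) (x : Icc (-a) a) :
    contExt ha f x = f x := contExt_of_mem ha f x.2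

theorem contExt_eqOn_ext (ha : 0 < a) (f : C(Icc (-a) a, ℂ)) :
    EqOn (contExt ha f) (ext f) (Icc (-a) a) := fun x hx => by
  rw [contExt_of_mem ha f hx]
  exact (ext_apply f ⟨x, hx⟩).symm

theorem exists_contExt_eqOn (ha : 0 < a) {f : ℝ → ℂ} (hf : ContinuousOn f (Icc (-a) a)) :
    ∃ g : C(Icc (-a) a, ℂ), EqOn (contExt ha g) f (Icc (-a) a) :=
  ⟨⟨(Icc (-a) a).domRestrict f, continuousOn_iff_continuous_domRestrict.1 hf⟩, fun x hx => by
    rw [contExt_of_mem ha _ hx]; rfl⟩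

theorem IsSolution.eqOn_of_initial (ha : 0 < a) {q : ℝ → ℂ} (hq : Continuous q) {ω : ℂ}
    {f g : ℝ → ℂ} (hf : IsSolution a q ω f) (hg : IsSolution a q ω g) (h0 : f 0 = g 0)
    (h1 : derivWithin f (Icc (-a) a) 0 = derivWithin g (Icc (-a) a) 0) :
    EqOn f g (Icc (-a) a) := by
  have hqω : Continuous fun s => q s - ω ^ 2 := hq.sub continuous_const
  have key : ∀ f : ℝ → ℂ, IsSolution a q ω f → ∃ F : ℝ → ℂ, Continuous F ∧ EqOn F f (Icc (-a) a) ∧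
      ∀ x ∈ Icc (-a) a, f x = f 0 + derivWithin f (Icc (-a) a) 0 * x +
        primitiveTwice (fun s => (q s - ω ^ 2) * F s) x := by
    intro f hf
    obtain ⟨F, hF⟩ := exists_contExt_eqOn ha hf.1.continuousOn
    refine ⟨contExt ha F, continuous_contExt ha F, hF, fun x hx => ?_⟩
    refine eq_taylor_of_contDiffOn_two ha hf.1 (hqω.mul (continuous_contExt ha F)) ?_ hx
    intro s hs
    change (q s - ω ^ 2) * contExt ha F s = _
    rw [hF hs]
    linear_combination -(hf.2 s hs)
  obtain ⟨F, hFc, hF, hf'⟩ := key f hf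
  obtain ⟨G, hGc, hG, hg'⟩ := key g hg
  have := eqOn_zero_of_eq_primitiveTwice (d := fun x => F x - G x) (p := fun s => q s - ω ^ 2)
    hqω (hFc.sub hGc).continuousOn fun x hx => by
      have hc : Continuous fun s => (q s - ω ^ 2) * (F s - G s) := hqω.mul (hFc.sub hGc)
      have hcG : Continuous fun s => (q s - ω ^ 2) * G s := hqω.mul hGc
      rw [hF hx, hG hx, hf' x hx, hg' x hx, h0, h1, add_sub_add_left_eq_sub, sub_eq_iff_eq_add,
        ← primitiveTwice_add hc hcG]
      congr 1
      funext s
      ring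
  exact fun x hx => by rw [← hF hx, ← hG hx]; exact sub_eq_zero.1 (this hx)

theorem exists_primitiveTwice_clm (ha : 0 < a) : ∃ J : C(Icc (-a) a, ℂ) →L[ℂ] C(Icc (-a) a, ℂ),
    ∀ p x, J p x = primitiveTwice (contExt ha p) x := by
  let A : C(Icc (-a) a, ℂ) →ₗ[ℂ] C(Icc (-a) a, ℂ) :=
    { toFun := fun p => ⟨fun x => primitiveTwice (contExt ha p) x,
        (continuous_primitiveTwice (continuous_contExt ha p)).comp continuous_subtype_val⟩
      map_add' := fun p r => ContinuousMap.ext fun x =>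
        primitiveTwice_add (continuous_contExt ha p) (continuous_contExt ha r) x
      map_smul' := fun c p => ContinuousMap.ext fun x =>
        primitiveTwice_const_mul c (contExt ha p) x }
  refine ⟨A.mkContinuous (a * a) fun p => ?_, fun p x => rfl⟩
  refine (ContinuousMap.norm_le _ (by positivity)).2 fun x => ?_
  change ‖∫ s in (0 : ℝ)..x, ∫ t in (0 : ℝ)..s, contExt ha p t‖ ≤ _
  have hle : ∀ x ∈ Icc (-a) a, |x - 0| ≤ a := fun x hx => by rw [sub_zero]; exact abs_le.2 hx
  have h1 : ∀ s ∈ uIoc 0 (x : ℝ), ‖∫ t in (0 : ℝ)..s, contExt ha p t‖ ≤ ‖p‖ * a := by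
    intro s hs
    refine (norm_integral_le_of_norm_le_const (C := ‖p‖) fun t _ => p.norm_coe_le_norm _).trans ?_
    gcongr
    exact hle s (uIcc_zero_subset x.2 (uIoc_subset_uIcc hs))
  refine (norm_integral_le_of_norm_le_const h1).trans ?_
  calc _ ≤ ‖p‖ * a * a := by gcongr; exact hle x x.2
    _ = _ := by ring

theorem continuous_volterra {K : ℝ → ℝ → ℂ} (hK : Continuous fun p : ℝ × ℝ => K p.1 p.2)
    {f : ℝ → ℂ} (hf : Continuous f) : Continuous (volterra K f) := by
  have hc : Continuous fun p : ℝ × ℝ => K p.1 p.2 * f p.2 := hK.mul (hf.comp continuous_snd)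
  have h1 : ∀ s : ℝ → ℝ, Continuous s → Continuous fun x : ℝ => ∫ t in (0 : ℝ)..s x, K x t * f t :=
    fun s hs => continuous_parametric_intervalIntegral_of_continuous
      (f := fun x t => K x t * f t) hc hs
  have h2 : volterra K f = fun x => f x +
      ((∫ t in (0 : ℝ)..x, K x t * f t) - ∫ t in (0 : ℝ)..(-x), K x t * f t) := by
    ext x
    rw [volterra, integral_interval_sub_left] <;>
      exact (hc.comp (Continuous.prodMk_right x)).intervalIntegrable _ _
  rw [h2]
  exact hf.add ((h1 _ continuous_id).sub (h1 _ continuous_neg))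

/-- The operator is written as 1 - A with A f = f - T f. Splitting the integral at 0 gives two
pieces with the factorial gain, whence the constant 2M. -/
theorem exists_volterra_clm (ha : 0 < a) {K : ℝ → ℝ → ℂ}
    (hK : Continuous fun p : ℝ × ℝ => K p.1 p.2) :
    ∃ T : C(Icc (-a) a, ℂ) →L[ℂ] C(Icc (-a) a, ℂ), IsUnit T ∧
      ∀ f x, T f x = volterra K (contExt ha f) x := by
  have hi : ∀ (f : C(Icc (-a) a, ℂ)) (x : ℝ), Continuous fun t => K x t * contExt ha f t :=
    fun f x => (hK.comp (Continuous.prodMk_right x)).mul (continuous_contExt ha f)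
  let A : C(Icc (-a) a, ℂ) →ₗ[ℂ] C(Icc (-a) a, ℂ) :=
    { toFun := fun f => ⟨fun x => contExt ha f x - volterra K (contExt ha f) x,
        ((continuous_contExt ha f).sub (continuous_volterra hK (continuous_contExt ha f))).comp
          continuous_subtype_val⟩
      map_add' := fun f g => ContinuousMap.ext fun x => by
        have e : ∀ t, contExt ha (f + g) t = contExt ha f t + contExt ha g t := fun _ => rfl
        simp only [ContinuousMap.coe_mk, ContinuousMap.add_apply, volterra, e, mul_add]
        rw [intervalIntegral.integral_add ((hi f x).intervalIntegrable _ _)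
          ((hi g x).intervalIntegrable _ _)]
        ring
      map_smul' := fun c f => ContinuousMap.ext fun x => by
        have e : ∀ t, contExt ha (c • f) t = c * contExt ha f t := fun _ => rfl
        simp only [ContinuousMap.coe_mk, ContinuousMap.smul_apply, volterra, e, smul_eq_mul,
          mul_left_comm _ c, RingHom.id_apply]
        rw [intervalIntegral.integral_const_mul]
        ring }
  obtain ⟨M, hM⟩ := ((isCompact_Icc (a := -a) (b := a)).prod
    (isCompact_Icc (a := -a) (b := a))).exists_bound_of_continuousOn hK.continuousOn
  have h0 : (0 : ℝ) ∈ Icc (-a) a := ⟨by linarith, ha.le⟩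
  have hM0 : 0 ≤ M := (norm_nonneg _).trans (hM (0, 0) ⟨h0, h0⟩)
  obtain ⟨B, hB, hu⟩ := exists_clm_isUnit_one_sub A (fun x => |(x : ℝ)|) a (2 * M)
    (fun _ => abs_nonneg _) (fun x => abs_le.2 x.2) ha.le (by positivity) (by
      intro n f L hL hf x
      change ‖contExt ha f x - volterra K (contExt ha f) x‖ ≤ _
      have hb : ∀ y ∈ Icc (-a) a, ‖∫ t in (0 : ℝ)..y, K x t * contExt ha f t‖ ≤
          M * L * |y| ^ (n + 1) / (n + 1)! := fun y hy =>
        norm_integral_le_pow_div_factorial fun t ht => by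
          have ht' := uIcc_zero_subset hy ht
          rw [norm_mul, contExt_of_mem ha f ht']
          calc _ ≤ M * (L * |t| ^ n / n !) :=
                mul_le_mul (hM (x, t) ⟨x.2, ht'⟩) (hf ⟨t, ht'⟩) (norm_nonneg _) hM0
            _ = _ := by ring
      rw [volterra, ← integral_interval_sub_left ((hi f x).intervalIntegrable _ _)
        ((hi f x).intervalIntegrable _ _), sub_add_cancel_left, norm_neg]
      refine (norm_sub_le _ _).trans ((add_le_add (hb x x.2)
        (hb (-x) ⟨by linarith [x.2.2], by linarith [x.2.1]⟩)).trans_eq ?_)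
      rw [abs_neg]
      ring)
  refine ⟨1 - B, hu, fun f x => ?_⟩
  have : (1 - B) f x = f x - A f x := by
    rw [← hB]
    rfl
  rw [this]
  change f x - (contExt ha f x - volterra K (contExt ha f) x) = _
  rw [contExt_val]
  ring

end Operators

/-! ### Uniqueness of the kernel and the intertwining identity. -/

section Transmutation

variable {a : ℝ}

/-- The functional k ↦ ∫ g k is bounded and vanishes on a dense subspace, so it vanishes at the
conjugate of g, where it is ∫ |g|². -/
theorem eq_zero_of_integral_exp_eq_zero {r : ℝ} (hr : 0 < r) {f : ℝ → ℂ}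
    (hf : ContinuousOn f (Icc (-r) r))
    (h : ∀ k : ℕ, ∫ t in (-r)..r, f t * Complex.exp ((k + 1 : ℂ) * (t : ℝ)) = 0) :
    EqOn f 0 (Icc (-r) r) := by
  obtain ⟨g, hg⟩ := exists_contExt_eqOn hr hf
  have hrr : -r ≤ r := by linarith
  have hi : ∀ k : C(Icc (-r) r, ℂ), Continuous fun t => contExt hr g t * contExt hr k t :=
    fun k => (continuous_contExt hr g).mul (continuous_contExt hr k)
  let Λ₀ : C(Icc (-r) r, ℂ) →ₗ[ℂ] ℂ :=
    { toFun := fun k => ∫ t in (-r)..r, contExt hr g t * contExt hr k t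
      map_add' := fun k l => by
        have e : ∀ t, contExt hr (k + l) t = contExt hr k t + contExt hr l t := fun _ => rfl
        simp only [e, mul_add]
        exact intervalIntegral.integral_add ((hi k).intervalIntegrable _ _)
          ((hi l).intervalIntegrable _ _)
      map_smul' := fun c k => by
        have e : ∀ t, contExt hr (c • k) t = c * contExt hr k t := fun _ => rfl
        simp only [e, mul_left_comm _ c, intervalIntegral.integral_const_mul, smul_eq_mul,
          RingHom.id_apply] }
  let Λ : C(Icc (-r) r, ℂ) →L[ℂ] ℂ := Λ₀.mkContinuous (‖g‖ * |r - -r|) fun k => by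
    refine (intervalIntegral.norm_integral_le_of_norm_le_const (C := ‖g‖ * ‖k‖) fun t _ => ?_).trans_eq (by ring)
    rw [norm_mul]
    exact mul_le_mul (g.norm_coe_le_norm _) (k.norm_coe_le_norm _) (norm_nonneg _) (norm_nonneg _)
  have hΛ : Λ = 0 := by
    refine ContinuousLinearMap.ext_on (dense_span_expMap hr) ?_
    rintro _ ⟨k, rfl⟩
    change ∫ t in (-r)..r, contExt hr g t * contExt hr (expMap r k) t = 0
    rw [← h k]
    refine intervalIntegral.integral_congr fun t ht => ?_
    rw [uIcc_of_le hrr] at ht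
    simp only [hg ht, contExt_of_mem hr _ ht]
    rfl
  have h1 : ∫ t in (-r)..r, (‖contExt hr g t‖ ^ 2 : ℝ) = 0 := by
    have h2 : ∫ t in (-r)..r, contExt hr g t * contExt hr (star g) t = 0 :=
      congrArg (fun M : C(Icc (-r) r, ℂ) →L[ℂ] ℂ => M (star g)) hΛ
    have h3 : ∀ t, contExt hr g t * contExt hr (star g) t = ((‖contExt hr g t‖ ^ 2 : ℝ) : ℂ) := by
      intro t
      push_cast
      exact Complex.mul_conj' _
    simp only [h3] at h2
    rw [intervalIntegral.integral_ofReal] at h2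
    exact_mod_cast h2
  intro x hx
  by_contra hne
  refine (intervalIntegral.integral_pos (f := fun t => ‖contExt hr g t‖ ^ 2) (by linarith)
    (((continuous_contExt hr g).norm.pow 2).continuousOn) (fun t _ => by positivity)
    ⟨x, hx, ?_⟩).ne' h1
  rw [hg hx]
  have : 0 < ‖f x‖ := norm_pos_iff.2 hne
  positivity

theorem hasDerivAt_cexp_mul (c : ℂ) (x : ℝ) :
    HasDerivAt (fun x : ℝ => Complex.exp (c * (x : ℝ))) (c * Complex.exp (c * (x : ℝ))) x := by
  have := ((hasDerivAt_ofReal x).const_mul c).cexp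
  simpa [mul_comm] using! this

theorem isSolution_of_hasDerivAt (ha : 0 < a) {ω : ℂ} {f w w₁ : ℝ → ℂ}
    (h₁ : ∀ x, HasDerivAt w (w₁ x) x) (h₂ : ∀ x, HasDerivAt w₁ (-ω ^ 2 * w x) x)
    (hf : EqOn f w (Icc (-a) a)) : IsSolution a (fun _ => 0) ω f := by
  have hw : Continuous w := continuous_iff_continuousAt.2 fun x => (h₁ x).continuousAt
  refine ⟨contDiffOn_two_of_eqOn h₁ h₂ (by fun_prop) hf, fun x hx => ?_⟩
  simp only [iteratedDerivWithin_two_eq_of_eqOn ha h₁ h₂ hf hx, hf hx]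
  ring

theorem isSolution_exp (ha : 0 < a) (c : ℂ) {f : ℝ → ℂ}
    (hf : EqOn f (fun x : ℝ => Complex.exp (c * (x : ℝ))) (Icc (-a) a)) :
    IsSolution a (fun _ => 0) (Complex.I * c) f :=
  isSolution_of_hasDerivAt ha (hasDerivAt_cexp_mul c) (fun x => by
    convert! (hasDerivAt_cexp_mul c x).const_mul c using 1
    rw [mul_pow, Complex.I_sq]
    ring) hf

theorem IsContinuousKernel.continuousOn_snd {K : ℝ → ℝ → ℂ} (hK : IsContinuousKernel a K) {x : ℝ}
    (hx : x ∈ Icc (-a) a) : ContinuousOn (K x) (Icc (-|x|) |x|) :=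
  hK.comp (f := fun t => (x, t)) (by fun_prop) fun _ ht => ⟨abs_le.2 hx, abs_le.2 ht⟩

/-- Both operators send e^{(k+1)t} to the same function, the Cauchy data at 0 being prescribed. For
each x ≠ 0 the difference of the kernels is therefore orthogonal to all these exponentials on [-|x|,
|x|]. -/
theorem MapsSolutions.kernel_unique (ha : 0 < a) {q : ℝ → ℂ} (hq : Continuous q) {h : ℂ}
    {K K' : ℝ → ℝ → ℂ} (hK : IsContinuousKernel a K) (hK' : IsContinuousKernel a K')
    (hm : MapsSolutions a q h K) (hm' : MapsSolutions a q h K') :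
    EqOn (fun p : ℝ × ℝ => K p.1 p.2) (fun p : ℝ × ℝ => K' p.1 p.2) (closedRegion a) := by
  have hint : ∀ x ∈ Icc (-a) a, ∀ k : ℕ, ∫ t in (-|x|)..|x|,
      (K x t - K' x t) * Complex.exp ((k + 1 : ℂ) * (t : ℝ)) = 0 := by
    intro x hx k
    set v : ℝ → ℂ := fun t => Complex.exp ((k + 1 : ℂ) * (t : ℝ))
    have hv := isSolution_exp ha (k + 1) (f := v) fun _ _ => rfl
    obtain ⟨h1, h2, h3⟩ := hm _ v hv
    obtain ⟨h1', h2', h3'⟩ := hm' _ v hv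
    have e := h1.eqOn_of_initial ha hq h1' (h2.trans h2'.symm) (h3.trans h3'.symm) hx
    have hvc : Continuous v := by fun_prop
    have hI : ∀ K : ℝ → ℝ → ℂ, IsContinuousKernel a K → ∀ y : ℝ, |y| = |x| →
        IntervalIntegrable (fun t => K x t * v t) volume (-y) y := by
      intro K hK y hy
      refine ContinuousOn.intervalIntegrable (((hK.continuousOn_snd hx).mono ?_).mul
        hvc.continuousOn)
      rw [← hy]
      exact uIcc_neg_subset (abs_le.1 le_rfl)
    have e1 : ∫ t in (-x)..x, (K x t - K' x t) * v t = 0 := by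
      simp only [sub_mul]
      rw [intervalIntegral.integral_sub (hI K hK x rfl) (hI K' hK' x rfl), sub_eq_zero]
      exact add_left_cancel e
    rcases abs_cases x with ⟨hx', -⟩ | ⟨hx', -⟩
    · rwa [hx']
    · rw [hx', neg_neg, intervalIntegral.integral_symm, e1, neg_zero]
  have hpos : ∀ x t : ℝ, x ≠ 0 → (x, t) ∈ closedRegion a → K x t = K' x t := by
    intro x t hx0 hxt
    have hx := abs_le.1 hxt.1
    exact sub_eq_zero.1 (eq_zero_of_integral_exp_eq_zero (abs_pos.2 hx0)
      ((hK.continuousOn_snd hx).sub (hK'.continuousOn_snd hx)) (hint x hx) (abs_le.1 hxt.2))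
  rintro ⟨x, t⟩ hxt
  by_cases hx0 : x = 0
  -- At x = 0 the operator does not see the kernel; the value K(0, 0) is recovered by continuity
  -- along (s, 0).
  · subst hx0
    have ht : t = 0 := by simpa using hxt.2
    subst ht
    have hcl : ∀ K : ℝ → ℝ → ℂ, IsContinuousKernel a K →
        Tendsto (fun s : ℝ => K s 0) (𝓝[>] 0) (𝓝 (K 0 0)) := by
      intro K hK
      refine (hK (0, 0) hxt).tendsto.comp (f := fun s : ℝ => (s, (0 : ℝ))) (tendsto_nhdsWithin_iff.2
        ⟨((by fun_prop : Continuous fun s : ℝ => (s, (0 : ℝ))).tendsto 0).mono_left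
          nhdsWithin_le_nhds, ?_⟩)
      filter_upwards [Ioo_mem_nhdsGT ha] with s hs
      exact ⟨by simpa [abs_of_pos hs.1] using hs.2.le, by simp⟩
    refine tendsto_nhds_unique (hcl K hK) ((hcl K' hK').congr' ?_)
    filter_upwards [Ioo_mem_nhdsGT ha] with s hs
    exact (hpos s 0 hs.1.ne' ⟨by simpa [abs_of_pos hs.1] using hs.2.le, by simp⟩).symm
  · exact hpos x t hx0 hxt

/-- The coordinate function on `[-a, a]`. -/
def coordMap (a : ℝ) : C(Icc (-a) a, ℂ) := ⟨fun x => ((x : ℝ) : ℂ), by fun_prop⟩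

section Structure

variable {q : ℝ → ℂ} {h : ℂ} {K : ℝ → ℝ → ℂ} {ha : 0 < a}
  {T J : C(Icc (-a) a, ℂ) →L[ℂ] C(Icc (-a) a, ℂ)} {Q : C(Icc (-a) a, ℂ)}

theorem eq_taylor_clm (hJ : ∀ p x, J p x = primitiveTwice (contExt ha p) x)
    {f : C(Icc (-a) a, ℂ)} {F : ℝ → ℂ} (hF : EqOn F (contExt ha f) (Icc (-a) a))
    (hf : ContDiffOn ℝ 2 F (Icc (-a) a))
    {p : C(Icc (-a) a, ℂ)}
    (hp : EqOn (contExt ha p) (iteratedDerivWithin 2 F (Icc (-a) a)) (Icc (-a) a)) {A B : ℂ}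
    (hA : F 0 = A) (hB : derivWithin F (Icc (-a) a) 0 = B) :
    f = A • 1 + B • coordMap a + J p := by
  subst hA hB
  ext x
  have := eq_taylor_of_contDiffOn_two ha hf (continuous_contExt ha p) hp x.2
  rw [hF x.2, contExt_val] at this
  rw [this]
  simp [hJ, coordMap]

/-- The equation u'' = (q - ω²)u for u = Tv and its initial data, in Taylor form as an identity in
C[-a, a]. -/
theorem MapsSolutions.clm_apply (hm : MapsSolutions a q h K)
    (hJ : ∀ p x, J p x = primitiveTwice (contExt ha p) x)
    (hT : ∀ f x, T f x = volterra K (contExt ha f) x) (hQ : EqOn (contExt ha Q) q (Icc (-a) a))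
    {ω : ℂ} {v : C(Icc (-a) a, ℂ)} {A B : ℂ} {w w₁ : ℝ → ℂ} (h₁ : ∀ x, HasDerivAt w (w₁ x) x)
    (h₂ : ∀ x, HasDerivAt w₁ (-ω ^ 2 * w x) x) (hv : EqOn (contExt ha v) w (Icc (-a) a))
    (hA : w 0 = A) (hB : w₁ 0 = B) :
    T v = A • 1 + (B + h * A) • coordMap a + J (Q * T v - ω ^ 2 • T v) := by
  have h0 : (0 : ℝ) ∈ Icc (-a) a := ⟨by linarith, ha.le⟩
  obtain ⟨hs, hi, hd⟩ := hm ω _ (isSolution_of_hasDerivAt ha h₁ h₂ hv)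
  rw [derivWithin_eq_of_eqOn ha h₁ hv h0, hv h0, hA, hB] at hd
  rw [hv h0, hA] at hi
  refine eq_taylor_clm hJ (F := volterra K (contExt ha v)) (fun x hx => ?_) hs.1 (fun x hx => ?_)
    hi hd
  · rw [contExt_of_mem ha _ hx, hT]
  · have h1 := hs.2 x hx
    have h2 := hQ hx
    rw [contExt_of_mem ha _ hx] at h2 ⊢
    simp only [ContinuousMap.sub_apply, ContinuousMap.mul_apply, ContinuousMap.smul_apply, hT,
      smul_eq_mul, h2]
    linear_combination -h1

/-- For f = A + Bx + Jp this encodes (Tf)'' = q Tf + T f'', with (Tf)(0) = A and (Tf)'(0) = B + hA.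
It is free of derivatives, hence closed under uniform limits in p. -/
theorem MapsSolutions.clm_comp_primitiveTwice (hm : MapsSolutions a q h K)
    (hJ : ∀ p x, J p x = primitiveTwice (contExt ha p) x)
    (hT : ∀ f x, T f x = volterra K (contExt ha f) x) (hQ : EqOn (contExt ha Q) q (Icc (-a) a))
    (A B : ℂ) (p : C(Icc (-a) a, ℂ)) :
    T (A • 1 + B • coordMap a + J p) = A • 1 + (B + h * A) • coordMap a +
      J (Q * T (A • 1 + B • coordMap a + J p) + T p) := by
  have t1 := hm.clm_apply hJ hT hQ (ω := 0) (v := 1) (w := fun _ => 1) (w₁ := fun _ => 0)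
    (fun x => hasDerivAt_const x _) (fun x => by simpa using hasDerivAt_const x (0 : ℂ))
    (fun x hx => by rw [contExt_of_mem ha _ hx]; rfl) rfl rfl
  have t2 := hm.clm_apply hJ hT hQ (ω := 0) (v := coordMap a) (w := fun x => (x : ℂ))
    (w₁ := fun _ => 1) hasDerivAt_ofReal (fun x => by simpa using hasDerivAt_const x (1 : ℂ))
    (fun x hx => by rw [contExt_of_mem ha _ hx]; rfl) Complex.ofReal_zero rfl
  -- For the exponential e with exponent c one has e = 1 + cx + J(c²e). Comparing T of both sides
  -- with the known Te, T1 and Tx gives the identity at c²e; since c ≠ 0, it holds at e.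
  have key : T.comp J = J.comp ((ContinuousLinearMap.mul ℂ C(Icc (-a) a, ℂ) Q).comp (T.comp J) + T) := by
    refine ContinuousLinearMap.ext_on (dense_span_expMap ha) ?_
    rintro _ ⟨k, rfl⟩
    set c : ℂ := k + 1 with hc
    have hc0 : c ≠ 0 := by rw [hc]; exact_mod_cast k.succ_ne_zero
    have hE : EqOn (contExt ha (expMap a k)) (fun x : ℝ => Complex.exp (c * (x : ℝ))) (Icc (-a) a) :=
      fun x hx => by rw [contExt_of_mem ha _ hx]; rfl
    have hω : -(Complex.I * c) ^ 2 = c ^ 2 := by rw [mul_pow, Complex.I_sq]; ring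
    have hd2 : ∀ x : ℝ, HasDerivAt (fun x : ℝ => c * Complex.exp (c * (x : ℝ)))
        (c ^ 2 * Complex.exp (c * (x : ℝ))) x := fun x => by
      convert! (hasDerivAt_cexp_mul c x).const_mul c using 1
      ring
    have t3 := hm.clm_apply hJ hT hQ (ω := Complex.I * c) (v := expMap a k) (A := 1) (B := c)
      (hasDerivAt_cexp_mul c) (fun x => by rw [hω]; exact hd2 x) hE (by simp) (by simp)
    have t4 := eq_taylor_clm hJ (f := expMap a k) (p := c ^ 2 • expMap a k)
      (F := fun x : ℝ => Complex.exp (c * (x : ℝ)))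
      hE.symm (contDiffOn_two_of_eqOn (hasDerivAt_cexp_mul c) hd2 (by fun_prop) fun _ _ => rfl)
      (fun x hx => by
        rw [iteratedDerivWithin_two_eq_of_eqOn ha (hasDerivAt_cexp_mul c) hd2 (fun _ _ => rfl) hx]
        change c ^ 2 * contExt ha (expMap a k) x = _
        rw [hE hx]) (A := 1) (B := c) (by simp) (by
        rw [derivWithin_eq_of_eqOn ha (hasDerivAt_cexp_mul c) (fun _ _ => rfl)
          (⟨by linarith, ha.le⟩ : (0 : ℝ) ∈ Icc (-a) a)]
        simp)
    change T (J (expMap a k)) = J (Q * T (J (expMap a k)) + T (expMap a k))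
    have t5 := congrArg T t4
    have t6 := congrArg (fun f => J (Q * T f)) t4
    simp only [map_add, map_smul, map_sub, mul_add, mul_smul_comm] at t1 t2 t3 t5 t6 ⊢
    rw [show (Complex.I * c) ^ 2 = -c ^ 2 by rw [← hω, neg_neg]] at t3
    have hc2 : c ^ 2 ≠ 0 := pow_ne_zero 2 hc0
    refine smul_right_injective _ hc2 ?_
    simp only
    linear_combination (norm := module) -t5 + t6 + t3 - t1 - c • t2
  have keyp : T (J p) = J (Q * T (J p) + T p) :=
    congrArg (fun S : C(Icc (-a) a, ℂ) →L[ℂ] C(Icc (-a) a, ℂ) => S p) key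
  simp only [map_add, map_smul, map_sub, mul_add, mul_smul_comm] at t1 t2 keyp ⊢
  linear_combination (norm := module) A • t1 + B • t2 + keyp

end Structure

end Transmutation

/-! ### From mapping solutions to transmutation. -/

section Existence

variable {a : ℝ}

/-- C² consists of the functions A + Bx + Jp, so the derivative-free identity shows that T preserves
it and intertwines the operators. Continuity of the inverse is inherited from C[-a, a] once T is
onto C². -/
theorem MapsSolutions.isTransmutation (ha : 0 < a) {q : ℝ → ℂ} (hq : Continuous q) {h : ℂ}
    {K : ℝ → ℝ → ℂ} (hK : Continuous fun p : ℝ × ℝ => K p.1 p.2) (hm : MapsSolutions a q h K) :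
    IsTransmutation a q K := by
  have h0 : (0 : ℝ) ∈ Icc (-a) a := ⟨by linarith, ha.le⟩
  obtain ⟨T, ⟨U, hU⟩, hT⟩ := exists_volterra_clm ha hK
  obtain ⟨J, hJ⟩ := exists_primitiveTwice_clm ha
  obtain ⟨Q, hQ⟩ := exists_contExt_eqOn ha hq.continuousOn
  have hcomp := hm.clm_comp_primitiveTwice hJ hT hQ
  have taylor : ∀ f ∈ C2 a, ∃ (A B : ℂ) (p : C(Icc (-a) a, ℂ)),
      EqOn (contExt ha p) (iteratedDerivWithin 2 (ext f) (Icc (-a) a)) (Icc (-a) a) ∧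
      f = A • 1 + B • coordMap a + J p := by
    intro f hf
    obtain ⟨p, hp⟩ := exists_contExt_eqOn ha (hasDerivWithinAt_of_contDiffOn_two ha hf).2.2
    exact ⟨_, _, p, hp, eq_taylor_clm hJ (contExt_eqOn_ext ha f).symm hf hp rfl rfl⟩
  have regular : ∀ (A B : ℂ) (p f : C(Icc (-a) a, ℂ)), f = A • 1 + B • coordMap a + J p →
      f ∈ C2 a ∧
      EqOn (iteratedDerivWithin 2 (ext f) (Icc (-a) a)) (contExt ha p) (Icc (-a) a) := by
    intro A B p f hf
    have e : EqOn (ext f) (fun x : ℝ => A + B * x + primitiveTwice (contExt ha p) x)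
        (Icc (-a) a) := fun x hx => by
      have h1 : ext f x = f ⟨x, hx⟩ := ext_apply f ⟨x, hx⟩
      rw [h1, hf]
      simp [hJ, coordMap]
    have d1 := hasDerivAt_taylor (continuous_contExt ha p) A B
    have d2 : ∀ x, HasDerivAt (fun x => B + ∫ t in (0 : ℝ)..x, contExt ha p t)
        (contExt ha p x) x := fun x => (hasDerivAt_primitive (continuous_contExt ha p) x).const_add B
    exact ⟨contDiffOn_two_of_eqOn d1 d2 (continuous_contExt ha p) e,
      iteratedDerivWithin_two_eq_of_eqOn ha d1 d2 e⟩
  have forward : ∀ f ∈ C2 a, T f ∈ C2 a := by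
    intro f hf
    obtain ⟨A, B, p, -, rfl⟩ := taylor f hf
    exact (regular _ _ _ _ (hcomp A B p)).1
  have backward : ∀ g ∈ C2 a, ∃ f ∈ C2 a, T f = g := by
    intro g hg
    obtain ⟨A, B, r, -, hgt⟩ := taylor g hg
    -- Forced by r = g'' = q Tf + T f'' with Tf = g. For the resulting f, the error d = Tf - g
    -- satisfies d = J(qd) and hence vanishes.
    set p := (↑U⁻¹ : C(Icc (-a) a, ℂ) →L[ℂ] C(Icc (-a) a, ℂ)) (r - Q * g) with hp
    have hTp : T p = r - Q * g := by
      rw [← hU]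
      exact congrArg (fun S : C(Icc (-a) a, ℂ) →L[ℂ] C(Icc (-a) a, ℂ) => S (r - Q * g)) U.mul_inv
    set f := A • 1 + (B - h * A) • coordMap a + J p with hf
    refine ⟨f, (regular _ _ _ _ hf).1, ?_⟩
    have hTf := hcomp A (B - h * A) p
    rw [← hf, hTp, sub_add_cancel] at hTf
    have hd : T f - g = J (Q * (T f - g)) := by
      calc T f - g = (A • 1 + B • coordMap a + J (Q * T f + (r - Q * g))) -
            (A • 1 + B • coordMap a + J r) := by rw [← hTf, ← hgt]
        _ = J (Q * T f + (r - Q * g)) - J r := by abel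
        _ = J (Q * (T f - g)) := by rw [← map_sub, mul_sub]; congr 1; abel
    have hz := eqOn_zero_of_eq_primitiveTwice (p := contExt ha Q) (d := contExt ha (T f - g))
      (continuous_contExt ha Q) (continuous_contExt ha _).continuousOn fun x hx => by
        rw [contExt_of_mem ha _ hx]
        conv_lhs => rw [hd]
        rw [hJ]
        rfl
    rw [← sub_eq_zero]
    ext x
    rw [← contExt_val ha]
    exact hz x.2
  let e : C(Icc (-a) a, ℂ) ≃L[ℂ] C(Icc (-a) a, ℂ) :=
    ContinuousLinearEquiv.unitsEquiv ℂ C(Icc (-a) a, ℂ) U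
  have he : ∀ f, e f = T f := fun f => by
    rw [← hU]
    rfl
  have hmap : (C2 a).map (e : C(Icc (-a) a, ℂ) →ₗ[ℂ] C(Icc (-a) a, ℂ)) = C2 a := by
    ext g
    constructor
    · rintro ⟨f, hf, rfl⟩
      change e f ∈ C2 a
      rw [he]
      exact forward f hf
    · intro hg
      obtain ⟨f, hf, hfg⟩ := backward g hg
      exact ⟨f, hf, (he f).trans hfg⟩
  refine ⟨e.ofSubmodules _ _ hmap, fun u x hx => ?_, fun u x hx => ?_⟩
  · rw [ContinuousLinearEquiv.ofSubmodules_apply, he, ← contExt_eqOn_ext ha _ hx,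
      contExt_of_mem ha _ hx, hT]
    exact volterra_congr (fun _ _ => rfl) (contExt_eqOn_ext ha _) hx
  · obtain ⟨A, B, p, hp, hu⟩ := taylor u.1 u.2
    have hTu := hcomp A B p
    rw [← hu] at hTu
    rw [ContinuousLinearEquiv.ofSubmodules_apply, he, schrodinger, (regular _ _ _ _ hTu).2 hx,
      ← contExt_eqOn_ext ha _ hx, ← hQ hx]
    have e1 : volterra K (schrodinger a (fun _ => 0) (ext u.1)) x = T (-p) ⟨x, hx⟩ := by
      rw [hT]
      refine volterra_congr (fun _ _ => rfl) (fun s hs => ?_) hx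
      have e2 : contExt ha (-p) s = -contExt ha p s := rfl
      rw [e2, hp hs, schrodinger]
      ring
    rw [e1, map_neg]
    simp only [contExt_of_mem ha _ hx, ContinuousMap.add_apply, ContinuousMap.mul_apply,
      ContinuousMap.neg_apply]
    ring

end Existence

/-! ### Independence of values outside the segment and the regions. -/

section Congruence

variable {a : ℝ} {q q' : ℝ → ℂ} {h : ℂ}

theorem IsSolution.congr (hq : EqOn q q' (Icc (-a) a)) {f g : ℝ → ℂ}
    (hfg : EqOn f g (Icc (-a) a)) {ω : ℂ} (hf : IsSolution a q ω f) : IsSolution a q' ω g := by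
  refine ⟨hf.1.congr hfg.symm, fun x hx => ?_⟩
  rw [← hq hx, ← hfg hx, ← iteratedDerivWithin_congr hfg hx]
  exact hf.2 x hx

theorem MapsSolutions.congr (ha : 0 < a) (hq : EqOn q q' (Icc (-a) a)) {K K' : ℝ → ℝ → ℂ}
    (hK : ∀ p ∈ closedRegion a, K p.1 p.2 = K' p.1 p.2) (hm : MapsSolutions a q h K) :
    MapsSolutions a q' h K' := by
  intro ω v hv
  have h0 : (0 : ℝ) ∈ Icc (-a) a := ⟨by linarith, ha.le⟩
  have e : EqOn (volterra K v) (volterra K' v) (Icc (-a) a) := volterra_congr hK fun _ _ => rfl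
  obtain ⟨h1, h2, h3⟩ := hm ω v hv
  refine ⟨h1.congr hq e, by rw [← e h0, h2], ?_⟩
  rw [← derivWithin_congr e (e h0), h3]

theorem IsTransmutation.congr (hq : EqOn q q' (Icc (-a) a)) {K K' : ℝ → ℝ → ℂ}
    (hK : ∀ p ∈ closedRegion a, K p.1 p.2 = K' p.1 p.2) (ht : IsTransmutation a q K) :
    IsTransmutation a q' K' := by
  obtain ⟨T, h1, h2⟩ := ht
  refine ⟨T, fun u x hx => ?_, fun u x hx => ?_⟩
  · rw [h1 u x hx]
    exact volterra_congr hK (fun _ _ => rfl) hx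
  · rw [← volterra_congr hK (fun _ _ => rfl) hx, ← h2 u x hx, schrodinger, schrodinger, hq hx]

theorem IsContinuousKernel.congr {K K' : ℝ → ℝ → ℂ}
    (hK : ∀ p ∈ closedRegion a, K p.1 p.2 = K' p.1 p.2) (hc : IsContinuousKernel a K) :
    IsContinuousKernel a K' :=
  ContinuousOn.congr hc fun p hp => (hK p hp).symm

theorem add_mem_Icc_of_mem_openTriangles {u v : ℝ} (h : (u, v) ∈ openTriangles a) :
    u + v ∈ Icc (-a) a := by
  rcases h with ⟨h1, h2, h3⟩ | ⟨h1, h2, h3⟩ <;> simp only at h1 h2 h3 <;>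
    constructor <;> linarith

theorem integral_zero_congr (hq : EqOn q q' (Icc (-a) a)) {u : ℝ} (hu : u ∈ Icc (-a) a) :
    ∫ s in (0 : ℝ)..u, q s = ∫ s in (0 : ℝ)..u, q' s :=
  intervalIntegral.integral_congr fun _ hs => hq (uIcc_zero_subset hu hs)

theorem isOpen_openTriangles (a : ℝ) : IsOpen (openTriangles a) := by
  have c1 : Continuous fun p : ℝ × ℝ => p.1 := continuous_fst
  have c2 : Continuous fun p : ℝ × ℝ => p.2 := continuous_snd
  exact ((isOpen_lt continuous_const c1).inter ((isOpen_lt continuous_const c2).inter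
    (isOpen_lt (c1.add c2) continuous_const))).union
    ((isOpen_lt c1 continuous_const).inter ((isOpen_lt c2 continuous_const).inter
    (isOpen_lt continuous_const (c1.add c2))))

theorem openTriangles_subset_closedTriangles (a : ℝ) : openTriangles a ⊆ closedTriangles a := by
  rintro p (⟨h1, h2, h3⟩ | ⟨h1, h2, h3⟩)
  · exact Or.inl ⟨h1.le, h2.le, h3.le⟩
  · exact Or.inr ⟨h1.le, h2.le, h3.le⟩

theorem IsGoursatSolution.congr (hq : EqOn q q' (Icc (-a) a)) {H H' : ℝ → ℝ → ℂ}
    (hH : ∀ p ∈ closedTriangles a, H p.1 p.2 = H' p.1 p.2) (hg : IsGoursatSolution a q h H) :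
    IsGoursatSolution a q' h H' := by
  obtain ⟨hc, ⟨Hu, Hv, cu, cv, hd⟩, b1, b2⟩ := hg
  refine ⟨hc.congr fun p hp => (hH p hp).symm, ⟨Hu, Hv, cu, cv, fun u v huv => ?_⟩,
    fun u hu => ?_, fun v hv => ?_⟩
  · rw [← hq (add_mem_Icc_of_mem_openTriangles huv),
      ← hH _ (openTriangles_subset_closedTriangles a huv)]
    have hnb := (isOpen_openTriangles a).mem_nhds huv
    have hsub : ∀ p ∈ openTriangles a, H' p.1 p.2 = H p.1 p.2 := fun p hp =>
      (hH p (openTriangles_subset_closedTriangles a hp)).symm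
    obtain ⟨d1, d2, d3, d4⟩ := hd u v huv
    refine ⟨d1.congr_of_eventuallyEq ?_, d2.congr_of_eventuallyEq ?_, d3, d4⟩
    · filter_upwards [(Continuous.prodMk_left v).continuousAt.preimage_mem_nhds hnb] with s hs
      exact hsub _ hs
    · filter_upwards [(Continuous.prodMk_right u).continuousAt.preimage_mem_nhds hnb] with s hs
      exact hsub _ hs
  · rw [← integral_zero_congr hq hu, ← b1 u hu]
    refine (hH (u, 0) ?_).symm
    rcases le_total 0 u with h | h
    · exact Or.inl ⟨h, le_rfl, by simpa using hu.2⟩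
    · exact Or.inr ⟨h, le_rfl, by simpa using hu.1⟩
  · rw [← b2 v hv]
    refine (hH (0, v) ?_).symm
    rcases le_total 0 v with h | h
    · exact Or.inl ⟨le_rfl, h, by simpa using hv.2⟩
    · exact Or.inr ⟨le_rfl, h, by simpa using hv.1⟩

theorem mem_closedTriangles_iff {u v : ℝ} :
    (u, v) ∈ closedTriangles a ↔ (u + v, u - v) ∈ closedRegion a := by
  simp only [closedTriangles, closedRegion, mem_ofPred_eq, abs_le, le_abs]
  grind

theorem mem_openTriangles_iff {u v : ℝ} :
    (u, v) ∈ openTriangles a ↔ (u + v, u - v) ∈ openRegion a := by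
  simp only [openTriangles, openRegion, mem_ofPred_eq, abs_lt, lt_abs]
  grind

end Congruence

/-! ### Regularity for a C¹ potential. -/

section Smoothness

theorem contDiff_one_integral_snd {ψ : ℝ → ℝ → ℂ} (hψ : ContDiff ℝ 1 fun p : ℝ × ℝ => ψ p.1 p.2) :
    ContDiff ℝ 1 fun p : ℝ × ℝ => ∫ β in (0 : ℝ)..p.2, ψ p.1 β := by
  set D := fderiv ℝ fun p : ℝ × ℝ => ψ p.1 p.2 with hD
  have hDc : Continuous fun p : ℝ × ℝ => D (p.1, p.2) (1, 0) :=
    (hψ.continuous_fderiv one_ne_zero).clm_apply continuous_const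
  have hd : ∀ u β, HasDerivAt (fun s => ψ s β) (D (u, β) (1, 0)) u := fun u β =>
    (hψ.differentiable one_ne_zero (u, β)).hasFDerivAt.comp_hasDerivAt
      (f := fun s : ℝ => (s, β)) u ((hasDerivAt_id u).prodMk (hasDerivAt_const u β))
  have := contDiffOn_succ_of_partials (n := 0) (F := fun u v => ∫ β in (0 : ℝ)..v, ψ u β)
    (F₁ := fun u v => ∫ β in (0 : ℝ)..v, D (u, β) (1, 0)) (F₂ := ψ) isOpen_univ
    (fun p _ => hasDerivAt_integral_param hψ.continuous hDc hd p.1 0 p.2)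
    (fun p _ => ((hψ.continuous.comp (Continuous.prodMk_right p.1)).integral_hasStrictDerivAt 0
      p.2).hasDerivAt)
    (contDiffOn_zero.2 (continuous_integral_snd (ψ := fun u β => D (u, β) (1, 0)) hDc).continuousOn)
    (contDiffOn_zero.2 hψ.continuous.continuousOn)
  simpa [contDiffOn_univ] using this

theorem contDiff_one_integral_fst {ψ : ℝ → ℝ → ℂ} (hψ : ContDiff ℝ 1 fun p : ℝ × ℝ => ψ p.1 p.2) :
    ContDiff ℝ 1 fun p : ℝ × ℝ => ∫ α in (0 : ℝ)..p.1, ψ α p.2 :=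
  (contDiff_one_integral_snd (ψ := fun v α => ψ α v)
    (hψ.comp (contDiff_snd.prodMk contDiff_fst))).comp (contDiff_snd.prodMk contDiff_fst)

variable {a : ℝ}

/-- Bootstrap: the right-hand side is C¹ on the plane whenever H is continuous. On the square it may
replace H under the integrals, so both first partials are C¹; the term q(u)/2 is what needs q to be
C¹. -/
theorem contDiffOn_two_of_eq_goursatRHS {q : ℝ → ℂ} {h : ℂ} {H : ℝ → ℝ → ℂ}
    (hq : ContDiff ℝ 1 q) (hH : Continuous fun p : ℝ × ℝ => H p.1 p.2)
    (hEq : ∀ u ∈ Icc (-a) a, ∀ v ∈ Icc (-a) a, H u v = goursatRHS q h H u v) :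
    ContDiffOn ℝ 2 (fun p : ℝ × ℝ => H p.1 p.2) (Ioo (-a) a ×ˢ Ioo (-a) a) := by
  have hqc := hq.continuous
  have hc : Continuous fun p : ℝ × ℝ => q (p.1 + p.2) * H p.1 p.2 :=
    (hqc.comp (by fun_prop)).mul hH
  have hR : ContDiff ℝ 1 fun p : ℝ × ℝ => goursatRHS q h H p.1 p.2 := by
    have := contDiffOn_succ_of_partials (n := 0) (F := goursatRHS q h H)
      (F₁ := fun u v => 1 / 2 * q u + ∫ β in (0 : ℝ)..v, q (u + β) * H u β)
      (F₂ := fun u v => ∫ α in (0 : ℝ)..u, q (α + v) * H α v) isOpen_univ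
      (fun p _ => hasDerivAt_goursatRHS_fst hqc h hH p.1 p.2)
      (fun p _ => hasDerivAt_goursatRHS_snd hqc h hH p.1 p.2)
      (contDiffOn_zero.2 ((continuous_const.mul (hqc.comp continuous_fst)).add
        (continuous_integral_snd (ψ := fun u β => q (u + β) * H u β) hc)).continuousOn)
      (contDiffOn_zero.2
        (continuous_integral_fst (ψ := fun α v => q (α + v) * H α v) hc).continuousOn)
    simpa [contDiffOn_univ] using this
  have hψ : ContDiff ℝ 1 fun p : ℝ × ℝ => q (p.1 + p.2) * goursatRHS q h H p.1 p.2 :=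
    (hq.comp (contDiff_fst.add contDiff_snd)).mul hR
  have hI : ∀ {w s : ℝ}, w ∈ Ioo (-a) a → s ∈ uIcc 0 w → s ∈ Icc (-a) a := fun hw hs =>
    uIcc_zero_subset (Ioo_subset_Icc_self hw) hs
  have := contDiffOn_succ_of_partials (n := 1) (F := H) (U := Ioo (-a) a ×ˢ Ioo (-a) a)
    (F₁ := fun u v => 1 / 2 * q u + ∫ β in (0 : ℝ)..v, q (u + β) * H u β)
    (F₂ := fun u v => ∫ α in (0 : ℝ)..u, q (α + v) * H α v)
    (isOpen_Ioo.prod isOpen_Ioo)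
    (fun p hp => (hasDerivAt_of_eq_goursatRHS hqc hH hEq hp.1 hp.2).1)
    (fun p hp => (hasDerivAt_of_eq_goursatRHS hqc hH hEq hp.1 hp.2).2)
    (by
      have h1 : ContDiff ℝ 1 fun p : ℝ × ℝ => 1 / 2 * q p.1 +
          ∫ β in (0 : ℝ)..p.2, q (p.1 + β) * goursatRHS q h H p.1 β :=
        (contDiff_const.mul (hq.comp contDiff_fst)).add
          (contDiff_one_integral_snd (ψ := fun u β => q (u + β) * goursatRHS q h H u β) hψ)
      refine h1.contDiffOn.congr fun p hp => ?_
      congr 1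
      refine intervalIntegral.integral_congr fun β hβ => ?_
      simp only [hEq p.1 (Ioo_subset_Icc_self hp.1) β (hI hp.2 hβ)])
    (by
      refine (contDiff_one_integral_fst
        (ψ := fun α v => q (α + v) * goursatRHS q h H α v) hψ).contDiffOn.congr fun p hp => ?_
      refine intervalIntegral.integral_congr fun α hα => ?_
      simp only [hEq α (hI hp.1 hα) p.2 (Ioo_subset_Icc_self hp.2)])
  have e : ((1 : ℕ) + 1 : WithTop ℕ∞) = 2 := by norm_num
  rwa [e] at this

theorem isOpen_openRegion (a : ℝ) : IsOpen (openRegion a) :=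
  (isOpen_lt continuous_fst.abs continuous_const).inter
    (isOpen_lt continuous_snd.abs continuous_fst.abs)

theorem contDiffOn_kernelOf {H : ℝ → ℝ → ℂ}
    (hH : ContDiffOn ℝ 2 (fun p : ℝ × ℝ => H p.1 p.2) (Ioo (-a) a ×ˢ Ioo (-a) a)) :
    ContDiffOn ℝ 2 (fun p : ℝ × ℝ => kernelOf H p.1 p.2) (openRegion a) := by
  refine hH.comp (f := fun p : ℝ × ℝ => ((p.1 + p.2) / 2, (p.1 - p.2) / 2))
    (((contDiff_fst.add contDiff_snd).div_const 2).prodMk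
      ((contDiff_fst.sub contDiff_snd).div_const 2)).contDiffOn fun p hp => ?_
  refine openTriangles_subset a (mem_openTriangles_iff.2 ?_)
  convert hp using 1
  ext <;> simp only <;> ring

/-- Extending q' continuously by constants and integrating keeps the extension C¹; extending q
itself by constants would create corners. -/
theorem exists_contDiff_eqOn (ha : 0 < a) {q : ℝ → ℂ} (hq : ContDiffOn ℝ 1 q (Icc (-a) a)) :
    ∃ Q : ℝ → ℂ, ContDiff ℝ 1 Q ∧ EqOn q Q (Icc (-a) a) := by
  have hu : UniqueDiffOn ℝ (Icc (-a) a) := uniqueDiffOn_Icc (by linarith)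
  obtain ⟨hd, hc⟩ := (contDiffOn_one_iff_derivWithin hu).1 hq
  obtain ⟨p, hp⟩ := exists_contExt_eqOn ha hc
  have hpd := hasDerivAt_primitive (continuous_contExt ha p)
  refine ⟨fun x => q 0 + ∫ t in (0 : ℝ)..x, contExt ha p t, contDiff_one_iff_deriv.2
    ⟨fun x => ((hpd x).const_add _).differentiableAt, ?_⟩, fun x hx => ?_⟩
  · rw [funext fun x => ((hpd x).const_add (q 0)).deriv]
    exact continuous_contExt ha p
  · have := eq_of_hasDerivWithinAt_zero (d := fun x => q x - ∫ t in (0 : ℝ)..x, contExt ha p t)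
      (fun x hx => by
        have := (hd x hx).hasDerivWithinAt.sub (hpd x).hasDerivWithinAt
        rwa [hp hx, sub_self] at this) hx
    simp only [integral_same, sub_zero] at this
    simp only [← this, sub_add_cancel]

end Smoothness

/-! ### The wave equation in characteristic coordinates. -/

section Hyperbolic

variable {a : ℝ} {q : ℝ → ℂ} {h : ℂ} {K : ℝ → ℝ → ℂ}

section Derivatives

variable {F : ℝ × ℝ → ℂ} {U : Set (ℝ × ℝ)} (hU : IsOpen U) (hF : ContDiffOn ℝ 2 F U)
  {l : ℝ → ℝ × ℝ} {e : ℝ × ℝ} {s : ℝ} (hl : HasDerivAt l e s) (hs : l s ∈ U)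

include hU hF hl hs

theorem hasDerivAt_comp_line : HasDerivAt (fun s => F (l s)) (fderiv ℝ F (l s) e) s :=
  ((hF.contDiffAt (hU.mem_nhds hs)).differentiableAt two_ne_zero).hasFDerivAt.comp_hasDerivAt s hl

theorem hasDerivAt_fderiv_comp_line (b : ℝ × ℝ) :
    HasDerivAt (fun s => fderiv ℝ F (l s) b) (fderiv ℝ (fderiv ℝ F) (l s) e b) s := by
  have h1 : ContDiffAt ℝ 1 (fderiv ℝ F) (l s) :=
    (hF.contDiffAt (hU.mem_nhds hs)).fderiv_right (by norm_num)
  have h2 := (h1.differentiableAt one_ne_zero).hasFDerivAt.comp_hasDerivAt s hl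
  have h3 := h2.clm_apply (hasDerivAt_const s b)
  simpa using! h3

theorem iteratedDeriv_two_comp_line (hline : ∀ s, HasDerivAt l e s) :
    iteratedDeriv 2 (fun s => F (l s)) s = fderiv ℝ (fderiv ℝ F) (l s) e e := by
  rw [iteratedDeriv_succ, iteratedDeriv_one]
  refine ((hasDerivAt_fderiv_comp_line hU hF hl hs e).congr_of_eventuallyEq ?_).deriv
  filter_upwards [hl.continuousAt.preimage_mem_nhds (hU.mem_nhds hs)] with y hy
  exact (hasDerivAt_comp_line hU hF (hline y) hy).deriv

end Derivatives

section SecondDerivatives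

variable (hF : ContDiffOn ℝ 2 (fun p : ℝ × ℝ => K p.1 p.2) (openRegion a))

include hF

/-- The factorization ∂_x² - ∂_t² = (∂_x - ∂_t)(∂_x + ∂_t); the cross terms cancel by symmetry of
the second derivative. -/
theorem wave_eq_fderiv {x t : ℝ} (hxt : (x, t) ∈ openRegion a) :
    iteratedDeriv 2 (fun s => K s t) x - iteratedDeriv 2 (fun s => K x s) t =
      fderiv ℝ (fderiv ℝ fun p : ℝ × ℝ => K p.1 p.2) (x, t) (1, -1) (1, 1) := by
  have h1 := iteratedDeriv_two_comp_line (isOpen_openRegion a) hF (l := fun s => (s, t))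
    ((hasDerivAt_id x).prodMk (hasDerivAt_const x t)) hxt
    fun s => (hasDerivAt_id s).prodMk (hasDerivAt_const s t)
  have h2 := iteratedDeriv_two_comp_line (isOpen_openRegion a) hF (l := fun s => (x, s))
    ((hasDerivAt_const t x).prodMk (hasDerivAt_id t)) hxt
    fun s => (hasDerivAt_const s x).prodMk (hasDerivAt_id s)
  have hsym := (hF.contDiffAt ((isOpen_openRegion a).mem_nhds hxt)).isSymmSndFDerivAt (by simp)
  have e1 : ((1 : ℝ), (-1 : ℝ)) = (1, 0) - (0, 1) := by simp
  have e2 : ((1 : ℝ), (1 : ℝ)) = (1, 0) + (0, 1) := by simp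
  simp only at h1 h2
  rw [h1, h2, e1, e2, map_add, map_sub, sub_apply,
    sub_apply, hsym (0, 1) (1, 0)]
  abel

theorem characteristic_derivatives {u v : ℝ} (huv : (u, v) ∈ openTriangles a) :
    HasDerivAt (fun s => K (s + v) (s - v))
      (fderiv ℝ (fun p : ℝ × ℝ => K p.1 p.2) (u + v, u - v) (1, 1)) u ∧
    HasDerivAt (fun s => K (u + s) (u - s))
      (fderiv ℝ (fun p : ℝ × ℝ => K p.1 p.2) (u + v, u - v) (1, -1)) v ∧
    HasDerivAt (fun s => fderiv ℝ (fun p : ℝ × ℝ => K p.1 p.2) (u + s, u - s) (1, 1))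
      (iteratedDeriv 2 (fun s => K s (u - v)) (u + v) -
        iteratedDeriv 2 (fun s => K (u + v) s) (u - v)) v ∧
    HasDerivAt (fun s => fderiv ℝ (fun p : ℝ × ℝ => K p.1 p.2) (s + v, s - v) (1, -1))
      (iteratedDeriv 2 (fun s => K s (u - v)) (u + v) -
        iteratedDeriv 2 (fun s => K (u + v) s) (u - v)) u := by
  have hm := mem_openTriangles_iff.1 huv
  have l1 : HasDerivAt (fun s : ℝ => (s + v, s - v)) (1, 1) u :=
    ((hasDerivAt_id u).add_const v).prodMk ((hasDerivAt_id u).sub_const v)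
  have l2 : HasDerivAt (fun s : ℝ => (u + s, u - s)) (1, -1) v :=
    ((hasDerivAt_id v).const_add u).prodMk ((hasDerivAt_id v).const_sub u)
  have hsym := (hF.contDiffAt ((isOpen_openRegion a).mem_nhds hm)).isSymmSndFDerivAt (by simp)
  rw [wave_eq_fderiv hF hm]
  refine ⟨hasDerivAt_comp_line (isOpen_openRegion a) hF l1 hm,
    hasDerivAt_comp_line (isOpen_openRegion a) hF l2 hm,
    hasDerivAt_fderiv_comp_line (isOpen_openRegion a) hF l2 hm _, ?_⟩
  rw [hsym]
  exact hasDerivAt_fderiv_comp_line (isOpen_openRegion a) hF l1 hm _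

/-- Once K is C², the u- and v-derivatives of K(u + v, u - v) are its derivatives along (1, 1) and
(1, -1), and their mixed derivative is the wave operator. -/
theorem isGoursatSolution_iff_isHyperbolicGoursatSolution :
    IsGoursatSolution a q h (fun u v => K (u + v) (u - v)) ↔
      IsHyperbolicGoursatSolution a q h K := by
  have hcF : ContinuousOn (fderiv ℝ fun p : ℝ × ℝ => K p.1 p.2) (openRegion a) :=
    hF.continuousOn_fderiv_of_isOpen (isOpen_openRegion a) one_le_two
  have hcF' : ∀ b, ContinuousOn (fun p : ℝ × ℝ =>
      fderiv ℝ (fun p : ℝ × ℝ => K p.1 p.2) (p.1 + p.2, p.1 - p.2) b) (openTriangles a) := fun b =>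
    (hcF.comp (f := fun p : ℝ × ℝ => (p.1 + p.2, p.1 - p.2)) (by fun_prop)
      fun p hp => mem_openTriangles_iff.1 hp).clm_apply continuousOn_const
  have hback : ∀ x t : ℝ, ((x + t) / 2 + (x - t) / 2, (x + t) / 2 - (x - t) / 2) = (x, t) :=
    fun x t => by ext <;> simp only <;> ring
  constructor
  · rintro ⟨hc, ⟨Hu, Hv, -, -, hd⟩, b1, b2⟩
    refine ⟨?_, hF, fun x t hxt => ?_, fun x hx => by simpa using b1 x hx,
      fun x hx => by simpa using b2 x hx⟩
    · refine (hc.comp (f := fun p : ℝ × ℝ => ((p.1 + p.2) / 2, (p.1 - p.2) / 2)) (by fun_prop)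
        fun p hp => mem_closedTriangles_iff.2 ?_).congr fun p _ => ?_
      · rwa [hback]
      · exact congrArg (fun p : ℝ × ℝ => K p.1 p.2) (hback p.1 p.2).symm
    · have hp : ((x + t) / 2, (x - t) / 2) ∈ openTriangles a :=
        mem_openTriangles_iff.2 (by rwa [hback])
      have e1 : (x + t) / 2 + (x - t) / 2 = x := by ring
      have e2 : (x + t) / 2 - (x - t) / 2 = t := by ring
      have h1 := (characteristic_derivatives hF hp).2.2.1
      have h2 := (hd _ _ hp).2.2.1
      -- The given `Hu` is known only as a derivative; by uniqueness it agrees near the point with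
      -- the directional derivative of K.
      have h3 := h2.congr_of_eventuallyEq (f₁ := fun s => fderiv ℝ (fun p : ℝ × ℝ => K p.1 p.2)
        ((x + t) / 2 + s, (x + t) / 2 - s) (1, 1)) (by
          filter_upwards [(Continuous.prodMk_right ((x + t) / 2)).continuousAt.preimage_mem_nhds
            ((isOpen_openTriangles a).mem_nhds hp)] with s hs
          exact (characteristic_derivatives hF hs).1.unique (hd _ _ hs).1)
      have h4 := h1.unique h3
      simp only [e1, e2] at h4
      linear_combination h4
  · rintro ⟨hc, -, hw, b1, b2⟩
    refine ⟨hc.comp (f := fun p : ℝ × ℝ => (p.1 + p.2, p.1 - p.2)) (by fun_prop)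
      fun p hp => mem_closedTriangles_iff.1 hp,
      ⟨fun u v => fderiv ℝ (fun p : ℝ × ℝ => K p.1 p.2) (u + v, u - v) (1, 1),
        fun u v => fderiv ℝ (fun p : ℝ × ℝ => K p.1 p.2) (u + v, u - v) (1, -1),
        hcF' (1, 1), hcF' (1, -1), fun u v huv => ?_⟩,
      fun u hu => by simpa using b1 u hu, fun v hv => by simpa using b2 v hv⟩
    have h1 := characteristic_derivatives hF huv
    have h2 : iteratedDeriv 2 (fun s => K s (u - v)) (u + v) -
        iteratedDeriv 2 (fun s => K (u + v) s) (u - v) = q (u + v) * K (u + v) (u - v) := by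
      linear_combination hw _ _ (mem_openTriangles_iff.1 huv)
    rwa [h2] at h1

end SecondDerivatives

end Hyperbolic

/-! ### Identification of the kernel and conclusion. -/

section Kernel

variable {a : ℝ} {q : ℝ → ℂ} {h : ℂ} {K K' : ℝ → ℝ → ℂ}

theorem forall_closedRegion_of_closedTriangles
    (hK : ∀ p ∈ closedTriangles a, K (p.1 + p.2) (p.1 - p.2) = K' (p.1 + p.2) (p.1 - p.2)) :
    ∀ p ∈ closedRegion a, K p.1 p.2 = K' p.1 p.2 := by
  rintro ⟨x, t⟩ hp
  have e1 : (x + t) / 2 + (x - t) / 2 = x := by ring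
  have e2 : (x + t) / 2 - (x - t) / 2 = t := by ring
  have := hK ((x + t) / 2, (x - t) / 2) (mem_closedTriangles_iff.2 (by rwa [e1, e2]))
  simpa only [e1, e2] using this

/-- For a continuous solution `H` of the integral equation on the square, each of the conditions on `K`
says that `K` coincides with `kernelOf H`. -/
theorem kernel_characterization (ha : 0 < a) {Q : ℝ → ℂ} (hQ : Continuous Q)
    (hqQ : EqOn q Q (Icc (-a) a)) {H : ℝ → ℝ → ℂ} (hH : Continuous fun p : ℝ × ℝ => H p.1 p.2)
    (hEq : ∀ u ∈ Icc (-a) a, ∀ v ∈ Icc (-a) a, H u v = goursatRHS Q h H u v) :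
    ((IsContinuousKernel a K ∧ MapsSolutions a q h K) →
      ∀ p ∈ closedRegion a, K p.1 p.2 = kernelOf H p.1 p.2) ∧
    (IsGoursatSolution a q h (fun u v => K (u + v) (u - v)) →
      ∀ p ∈ closedRegion a, K p.1 p.2 = kernelOf H p.1 p.2) ∧
    ((∀ p ∈ closedRegion a, K p.1 p.2 = kernelOf H p.1 p.2) →
      IsTransmutationKernel a q h K ∧ IsGoursatSolution a q h (fun u v => K (u + v) (u - v))) := by
  have hc := continuous_kernelOf hH
  have hm := mapsSolutions_kernelOf ha hQ hH hEq
  have ht := hm.isTransmutation ha hQ hc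
  have hg : IsGoursatSolution a Q h fun u v => kernelOf H (u + v) (u - v) := by
    simp only [kernelOf_add_sub]
    exact isGoursatSolution_of_eq_goursatRHS ha hQ hH hEq
  refine ⟨fun hK => ?_, fun hK => ?_, fun hK => ⟨⟨?_, ?_, ?_⟩, ?_⟩⟩
  · exact fun p hp => (hK.2.congr ha hqQ fun _ _ => rfl).kernel_unique ha hQ hK.1 hc.continuousOn
      hm hp
  · exact forall_closedRegion_of_closedTriangles fun p hp =>
      (hK.congr hqQ fun _ _ => rfl).eqOn ha hQ.continuousOn hg hp
  · exact IsContinuousKernel.congr (fun p hp => (hK p hp).symm) hc.continuousOn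
  · exact ht.congr hqQ.symm fun p hp => (hK p hp).symm
  · exact hm.congr ha hqQ.symm fun p hp => (hK p hp).symm
  · exact hg.congr hqQ.symm fun p hp => (hK _ (mem_closedTriangles_iff.1 hp)).symm

end Kernel

end DarbouxTransmutation

end

theorem mainTheorem5 (a : ℝ) (ha : 0 < a) (q : ℝ → ℂ)
    (hq : ContinuousOn q (Set.Icc (-a) a)) (h : ℂ) (K : ℝ → ℝ → ℂ) :
    List.TFAE [
      DarbouxTransmutation.IsTransmutationKernel a q h K,
      DarbouxTransmutation.IsContinuousKernel a K ∧ DarbouxTransmutation.MapsSolutions a q h K,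
      DarbouxTransmutation.IsGoursatSolution a q h (fun u v => K (u + v) (u - v))] ∧
    (ContDiffOn ℝ 1 q (Set.Icc (-a) a) →
      (DarbouxTransmutation.IsTransmutationKernel a q h K ↔
        DarbouxTransmutation.IsHyperbolicGoursatSolution a q h K)) := by
  open DarbouxTransmutation in
  constructor
  -- A continuous extension of q suffices here; the C¹ statement below needs a C¹ extension, and
  -- thus its own H.
  · obtain ⟨Q, hqQ⟩ := exists_contExt_eqOn ha hq
    obtain ⟨H, hH, hEq⟩ := exists_eq_goursatRHS ha (continuous_contExt ha Q) h
    obtain ⟨c1, c2, c3⟩ :=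
      kernel_characterization (K := K) ha (continuous_contExt ha Q) hqQ.symm hH hEq
    tfae_have 1 → 2 := fun hK => ⟨hK.1, hK.2.2⟩
    tfae_have 2 → 3 := fun hK => (c3 (c1 hK)).2
    tfae_have 3 → 1 := fun hK => (c3 (c2 hK)).1
    tfae_finish
  · intro hq1
    obtain ⟨Q, hQ, hqQ⟩ := exists_contDiff_eqOn ha hq1
    obtain ⟨H, hH, hEq⟩ := exists_eq_goursatRHS ha hQ.continuous h
    obtain ⟨c1, c2, c3⟩ := kernel_characterization (K := K) ha hQ.continuous hqQ hH hEq
    constructor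
    · intro hK
      have hE := c1 ⟨hK.1, hK.2.2⟩
      refine (isGoursatSolution_iff_isHyperbolicGoursatSolution ?_).1 (c3 hE).2
      refine (contDiffOn_kernelOf (contDiffOn_two_of_eq_goursatRHS hQ hH hEq)).congr
        fun p hp => hE p ⟨hp.1.le, hp.2.le⟩
    · intro hK
      exact (c3 (c2 ((isGoursatSolution_iff_isHyperbolicGoursatSolution hK.2.1).2 hK))).1
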